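/- Let $M_n$ denote the abelian group of homogeneous polynomials of degree $n\ge 0$ in $\mathbb Z[x,y]$. The group $SL_2(\mathbb Z)$ acts on $\mathbb Z[x,y]$ by ring automorphisms and on each $M_n$, a matrix $A=(a_{ij})$ acting by the substitution $x\mapsto a_{11}x+a_{21}y$, $y\mapsto a_{12}x+a_{22}y$. Let $$s_1=\begin{pmatrix}1&0\\-1&1\end{pmatrix},\qquad s_2=\begin{pmatrix}1&1\\0&1\end{pmatrix},$$ let $\Gamma(2)$ be the kernel of reduction modulo $2$, $SL_2(\mathbb Z)\to SL_2(\mathbb Z/2)$, and let $F_2\subset\Gamma(2)$ be the subgroup generated by $s_1^2$ and $s_2^2$. Write $\mathbb Z_2=\mathbb Z/2\mathbb Z$, with trivial action; all tensor products are over $\mathbb Z$. Then $F_2$ is freely generated by $s_1^2,s_2^2$, and $\Gamma(2)$ is the internal direct product $F_2\times\{I,-I\}$. Moreover the following isomorphisms of abelian groups hold. For $n$ even: $$H^0(\Gamma(2);M_n)\cong H^0(F_2;M_n)\cong\begin{cases}\mathbb Z & n=0,\\ 0& n>0,\end{cases}\qquad H^1(\Gamma(2);M_n)\cong H^1(F_2;M_n),$$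 where the isomorphisms from the cohomology of $\Gamma(2)$ to that of $F_2$ in degrees $0$ and $1$ are the restriction maps; and for all $i>0$ $$H^{2i}(\Gamma(2);M_n)\cong H^0(F_2;M_n\otimes\mathbb Z_2)\cong M_n\otimes\mathbb Z_2,\qquad H^{2i+1}(\Gamma(2);M_n)\cong H^1(F_2;M_n)\otimes\mathbb Z_2.$$ For $n$ odd: $H^0(\Gamma(2);M_n)= H^0(F_2;M_n)=0$, and for all $i>0$ $$H^{2i-1}(\Gamma(2);M_n)\cong H^0(F_2;M_n\otimes\mathbb Z_2)\cong M_n\otimes\mathbb Z_2,$$ $$H^{2i}(\Gamma(2);M_n)\cong H^1(F_2;M_n)\otimes\mathbb Z_2\cong H^1(F_2;M_n\otimes\mathbb Z_2).$$ Finally, for every $n\ge 0$, $$H^1(F_2;M_n\otimes\mathbb Z_2)\cong(M_n\oplus M_n)\otimes\mathbb Z_2.$$ -/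

import Mathlib

open scoped MatrixGroups TensorProduct

namespace CongruenceCohomology

/-- The matrix `s₁ = (1 0; -1 1)`. -/
def s₁ : SL(2, ℤ) := ⟨!![1, 0; -1, 1], by simp⟩

/-- The matrix `s₂ = (1 1; 0 1)`. -/
def s₂ : SL(2, ℤ) := ⟨!![1, 1; 0, 1], by simp⟩

/-- The principal congruence subgroup `Γ(2)` of `SL(2, ℤ)`. -/
abbrev Gamma2 : Subgroup SL(2, ℤ) := CongruenceSubgroup.Gamma 2

/-- The subgroup `F₂` of `SL(2, ℤ)` generated by `s₁²` and `s₂²`. -/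
def F₂ : Subgroup SL(2, ℤ) := Subgroup.closure {s₁ ^ 2, s₂ ^ 2}

theorem F₂_le_Gamma2 : F₂ ≤ Gamma2 := by
  rw [F₂, Subgroup.closure_le]
  rintro A (rfl | rfl)
  · change (s₁ ^ 2) ∈ CongruenceSubgroup.Gamma 2
    rw [CongruenceSubgroup.Gamma_mem]
    simp [s₁]
    decide
  · change (s₂ ^ 2) ∈ CongruenceSubgroup.Gamma 2
    rw [CongruenceSubgroup.Gamma_mem]
    simp [s₂]
    decide

/-- The linear substitution of variables given by a `2 × 2` integer matrix on `ℤ[x, y]`, with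
`x = X 0` and `y = X 1`: the variable `X j` goes to `∑ i, A i j • X i`, that is, to the `j`-th
column of `A`, when `ℤ²` is identified with the span of `x` and `y`. -/
noncomputable def subst (A : Matrix (Fin 2) (Fin 2) ℤ) :
    MvPolynomial (Fin 2) ℤ →ₐ[ℤ] MvPolynomial (Fin 2) ℤ :=
  MvPolynomial.aeval fun j => ∑ i, A i j • MvPolynomial.X i

theorem subst_one : subst 1 = AlgHom.id ℤ _ := by
  ext j : 1
  fin_cases j <;> simp [subst]

theorem subst_mul (A B : Matrix (Fin 2) (Fin 2) ℤ) :
    subst (A * B) = (subst A).comp (subst B) := by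
  ext j : 1
  simp only [subst, MvPolynomial.aeval_X, AlgHom.comp_apply, map_add, map_smul,
    Fin.sum_univ_two, Matrix.mul_apply, add_smul, smul_add, smul_smul]
  rw [mul_comm (A 0 0), mul_comm (A 0 1), mul_comm (A 1 0), mul_comm (A 1 1)]
  abel

/-- The action of `SL(2, ℤ)` on `M = ℤ[x, y]` by linear substitutions; it satisfies
`s₁ : x ↦ x - y, y ↦ y` and `s₂ : x ↦ x, y ↦ x + y`. -/
noncomputable def polyRep : Representation ℤ SL(2, ℤ) (MvPolynomial (Fin 2) ℤ) where
  toFun A := (subst A.1).toLinearMap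
  map_one' := by
    rw [Matrix.SpecialLinearGroup.coe_one, subst_one]
    rfl
  map_mul' A B := by
    rw [Matrix.SpecialLinearGroup.coe_mul, subst_mul]
    rfl

theorem s₁_x : polyRep s₁ (MvPolynomial.X 0) = MvPolynomial.X 0 - MvPolynomial.X 1 := by
  simp [polyRep, subst, s₁, sub_eq_add_neg]

theorem s₁_y : polyRep s₁ (MvPolynomial.X 1) = MvPolynomial.X 1 := by
  simp [polyRep, subst, s₁]

theorem s₂_x : polyRep s₂ (MvPolynomial.X 0) = MvPolynomial.X 0 := by
  simp [polyRep, subst, s₂]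

theorem s₂_y : polyRep s₂ (MvPolynomial.X 1) = MvPolynomial.X 0 + MvPolynomial.X 1 := by
  simp [polyRep, subst, s₂]

/-- `M_n`, the abelian group of homogeneous polynomials of degree `n` in `ℤ[x, y]`. -/
abbrev M (n : ℕ) : Submodule ℤ (MvPolynomial (Fin 2) ℤ) :=
  MvPolynomial.homogeneousSubmodule (Fin 2) ℤ n

theorem M_le_comap (n : ℕ) (A : SL(2, ℤ)) : M n ≤ (M n).comap (polyRep A) := by
  intro p hp
  have h : (subst A.1 p).IsHomogeneous (1 * n) := by
    refine MvPolynomial.IsHomogeneous.aeval hp _ fun j => ?_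
    refine MvPolynomial.IsHomogeneous.sum _ _ _ fun i _ => ?_
    exact (MvPolynomial.homogeneousSubmodule (Fin 2) ℤ 1).smul_mem _
      (MvPolynomial.isHomogeneous_X ℤ i)
  rw [one_mul] at h
  exact h

/-- `M_n` as a representation of `SL(2, ℤ)`. -/
noncomputable def repM (n : ℕ) : Representation ℤ SL(2, ℤ) (M n) :=
  polyRep.subrepresentation (M n) (M_le_comap n)

/-- `M_n ⊗ ℤ/2` as a representation of `SL(2, ℤ)`, with the trivial action on `ℤ/2`. -/
noncomputable def repMmod2 (n : ℕ) : Representation ℤ SL(2, ℤ) (M n ⊗[ℤ] ZMod 2) :=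
  (repM n).tprod (Representation.trivial ℤ SL(2, ℤ) (ZMod 2))

/-- `Hʲ(G; M_n)` for a subgroup `G` of `SL(2, ℤ)`. -/
noncomputable abbrev H (j : ℕ) (G : Subgroup SL(2, ℤ)) (n : ℕ) : ModuleCat ℤ :=
  groupCohomology (Rep.of ((repM n).comp G.subtype)) j

/-- `Hʲ(G; M_n ⊗ ℤ/2)` for a subgroup `G` of `SL(2, ℤ)`. -/
noncomputable abbrev Hmod2 (j : ℕ) (G : Subgroup SL(2, ℤ)) (n : ℕ) : ModuleCat ℤ :=
  groupCohomology (Rep.of ((repMmod2 n).comp G.subtype)) j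

/-- The restriction homomorphism `Hʲ(Γ(2); M_n) → Hʲ(F₂; M_n)`. -/
noncomputable def restriction (j n : ℕ) : H j Gamma2 n ⟶ H j F₂ n :=
  groupCohomology.map (Subgroup.inclusion F₂_le_Gamma2)
    (Rep.ofHom ⟨LinearMap.id, fun _ => rfl⟩) j

end CongruenceCohomology

/-! Let `c = -I`. The upper left entry modulo four gives a sign character χ of Γ(2) with χ(c) = -1
and kernel F₂; ping-pong shows that F₂ is free on the two squares, and Euclidean descent that it is
all of ker χ. A free group has no cohomology above degree one.

For a Γ(2)-module A there is an exact sequence 0 → A → Coind Res A → A⊗χ → 0, with (co)restriction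
to F₂ and last map f ↦ f(1) - c f(c). By Shapiro the middle term has the cohomology of F₂, so
H^{m+1}(A) ≅ H^m(A⊗χ) for m ≥ 2, and H²(A) is the cokernel of H¹(Coind Res A) → H¹(A⊗χ). Twisting
twice does nothing, so degrees one and two determine the rest, with period two.

Let A have no 2-torsion and trivial action modulo two, as M_n has; on M_n, c acts by (-1)^n. If c =
-1 on A, comparing z(cg) with z(gc) gives 2z(g) = z(c) - g z(c), and z ↦ z(c) induces H¹(A) ≅ A/2A.
If c = 1 on A, restriction identifies H¹(A) with H¹(F₂; A), and the map H¹(Coind Res A) → H¹(A⊗χ)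
vanishes, so H²(A) ≅ H¹(A⊗χ) ≅ A/2A. If c = -1, the image of that map is exactly 2H¹(A⊗χ), so H²(A)
≅ H¹(F₂; A)/2.

Crossed homomorphisms on F₂ are pairs of values at the generators, and principal ones vanish modulo
two, which gives H¹(F₂; M_n)/2. -/

/-! ### Embedding a module into a coinduced one -/

namespace Rep

open CategoryTheory

variable {k G : Type} [CommRing k] [Group G]

/-- A sequence of representations is short exact if its underlying sequence of modules is. -/
theorem shortExact_of_linear (X : ShortComplex (Rep.{0} k G))
    (hf : Function.Injective X.f.hom) (hg : Function.Surjective X.g.hom)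
    (h : ∀ x, X.g.hom x = 0 → ∃ y, X.f.hom y = x) : X.ShortExact where
  exact := by
    rw [← ShortComplex.exact_map_iff_of_faithful X (forget₂ (Rep.{0} k G) (ModuleCat k)),
      ShortComplex.moduleCat_exact_iff]
    exact h
  mono_f := (mono_iff_injective _).2 hf
  epi_g := (epi_iff_surjective _).2 hg

/-- The unit `A ⟶ Coind Res A`, which sends `a` to `g ↦ g a`. -/
noncomputable def toCoind (A : Rep.{0} k G) (S : Subgroup G) :
    A ⟶ coind S.subtype (res S.subtype A) :=
  ofHom
    { toFun a := ⟨fun g => A.ρ g a, fun s g => by simp⟩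
      map_add' a b := by ext; simp
      map_smul' r a := by ext; simp
      isIntertwining' g := by
        ext a h
        change A.ρ h (A.ρ g a) = A.ρ (h * g) a
        simp }

theorem toCoind_injective (A : Rep.{0} k G) (S : Subgroup G) :
    Function.Injective (toCoind A S).hom := by
  intro a b h
  have h1 := congrArg (fun f => f.1 1) h
  change A.ρ 1 a = A.ρ 1 b at h1
  simpa using h1

/-- Used with the trivial subgroup for dimension shifting: the middle term is then acyclic in
positive degrees. -/
theorem exists_shortExact_toCoind (A : Rep.{0} k G) (S : Subgroup G) :
    ∃ (B : Rep.{0} k G) (g : coind S.subtype (res S.subtype A) ⟶ B) (w : toCoind A S ≫ g = 0),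
      (ShortComplex.mk _ g w).ShortExact := by
  let W := LinearMap.range (toCoind A S).hom.toLinearMap
  let C := coind S.subtype (res S.subtype A)
  have hW : ∀ g, W ≤ W.comap (C.ρ g) := by
    rintro g _ ⟨a, rfl⟩
    exact ⟨A.ρ g a, hom_comm_apply _ _ _⟩
  refine ⟨C.quotient W hW, ofHom ⟨W.mkQ, fun g => rfl⟩, ?_, shortExact_of_linear _ ?_ ?_ ?_⟩
  · ext a
    exact (Submodule.Quotient.mk_eq_zero W).2 ⟨a, rfl⟩
  · exact toCoind_injective A S
  · exact W.mkQ_surjective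
  · intro x hx
    exact (Submodule.Quotient.mk_eq_zero W).1 hx

end Rep

/-! ### Cohomology of free groups -/

namespace groupCohomology

open CategoryTheory

variable {k G : Type} [CommRing k] [Group G]

/-- Higher cohomology vanishes on modules coinduced from the trivial subgroup. -/
theorem isZero_coind_bot (A : Rep.{0} k (⊥ : Subgroup G)) (n : ℕ) :
    Limits.IsZero (groupCohomology (Rep.coind (⊥ : Subgroup G).subtype A) (n + 1)) :=
  (isZero_groupCohomology_succ_of_subsingleton A n).of_iso (coindIso A (n + 1))

section LongExactSequence

variable {X : ShortComplex (Rep.{0} k G)} (hX : X.ShortExact)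

theorem δ_map_apply (i : ℕ) (x : groupCohomology X.X₂ i) :
    δ hX i (i + 1) rfl (map (MonoidHom.id G) X.g i x) = 0 :=
  congr($((mapShortComplex₃ hX (i := i) rfl).zero) x)

theorem exists_map_eq_of_δ_eq_zero (i : ℕ) (x : groupCohomology X.X₃ i)
    (hx : δ hX i (i + 1) rfl x = 0) : ∃ y, map (MonoidHom.id G) X.g i y = x :=
  (ShortComplex.moduleCat_exact_iff _).1 (mapShortComplex₃_exact hX (i := i) rfl) x hx

end LongExactSequence

section Free

variable {α : Type} (e : FreeGroup α ≃* G)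
include e

/-- Crossed homomorphisms on a free group have arbitrary values at the generators. -/
theorem exists_cocycle_of_free (A : Rep.{0} k G) (v : α → A) :
    ∃ z : cocycles₁ A, ∀ i, z (e (FreeGroup.of i)) = v i := by
  let φ : G →* MulAut (Multiplicative A) :=
    { toFun g := AddEquiv.toMultiplicative
        { A.ρ g with
          invFun := A.ρ g⁻¹
          left_inv := fun a => by simp
          right_inv := fun a => by simp }
      map_one' := by ext; simp
      map_mul' g h := by ext; simp }
  -- A crossed homomorphism is the same as a homomorphic section of `A ⋊ G → G`, and freeness lets
  -- the images of the generators be chosen at will.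
  let F : FreeGroup α →* Multiplicative A ⋊[φ] G :=
    FreeGroup.lift fun i => ⟨Multiplicative.ofAdd (v i), e (FreeGroup.of i)⟩
  have hF : (SemidirectProduct.rightHom.comp F) = e.toMonoidHom := by
    ext i; simp [F]
  have hr (g : G) : (F (e.symm g)).right = g := by
    simpa using DFunLike.congr_fun hF (e.symm g)
  refine ⟨⟨fun g => (F (e.symm g)).left.toAdd, (mem_cocycles₁_iff _).2 fun g h => ?_⟩, fun i => ?_⟩
  · rw [map_mul, map_mul, SemidirectProduct.mul_left, hr, toAdd_mul, add_comm]
    rfl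
  · change (F (e.symm (e (FreeGroup.of i)))).left.toAdd = v i
    simp [F]

theorem cocycle_ext_of_free {A : Rep.{0} k G} {z w : cocycles₁ A}
    (h : ∀ i, z (e (FreeGroup.of i)) = w (e (FreeGroup.of i))) : z = w := by
  have key : ∀ x : FreeGroup α, z (e x) = w (e x) := by
    intro x
    induction x using FreeGroup.induction_on with
    | C1 => simp
    | of i => exact h i
    | inv_of i hi =>
      have h1 := cocycles₁_map_inv z (e (FreeGroup.of i))
      have h2 := cocycles₁_map_inv w (e (FreeGroup.of i))
      rw [h i, ← h2] at h1
      rw [map_inv]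
      exact A.ρ.apply_bijective (e (FreeGroup.of i)) |>.1 h1
    | mul x y hx hy =>
      rw [map_mul, (mem_cocycles₁_iff z).1 z.2, (mem_cocycles₁_iff w).1 w.2, hx, hy]
  ext g
  simpa using key (e.symm g)

/-- The first cohomology of a free group is right exact. -/
theorem map_H1_surjective_of_free {A B : Rep.{0} k G} (f : A ⟶ B)
    (hf : Function.Surjective f.hom) : Function.Surjective (map (MonoidHom.id G) f 1) := by
  intro y
  induction y using H1_induction_on with | h y =>
  choose s hs using hf
  obtain ⟨z, hz⟩ := exists_cocycle_of_free e A fun i => s (y (e (FreeGroup.of i)))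
  refine ⟨H1π A z, ?_⟩
  rw [H1π_comp_map_apply]
  congr 1
  refine cocycle_ext_of_free e fun i => ?_
  rw [coe_mapCocycles₁]
  exact (congrArg f.hom (hz i)).trans (hs _)

/-- A free group has cohomological dimension at most one. -/
theorem isZero_of_free (n : ℕ) (A : Rep.{0} k G) : Limits.IsZero (groupCohomology A (n + 2)) := by
  induction n generalizing A with
  | zero =>
    obtain ⟨B, g, w, hX⟩ := Rep.exists_shortExact_toCoind A ⊥
    -- Each class in `H²(A)` is δ of a class in `H¹(B)`, which lifts to the coinduced module by
    -- right exactness of `H¹`; δ kills such classes.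
    have h2 := (ModuleCat.epi_iff_surjective _).1 (epi_δ_of_isZero hX 1 (isZero_coind_bot _ 1))
    have hs := map_H1_surjective_of_free e g ((Rep.epi_iff_surjective _).1 hX.epi_g)
    refine ModuleCat.isZero_iff_subsingleton.2 (subsingleton_of_forall_eq 0 fun x => ?_)
    obtain ⟨y, rfl⟩ := h2 x
    obtain ⟨y, rfl⟩ := hs y
    exact δ_map_apply hX 1 y
  | succ n ih =>
    obtain ⟨B, g, w, hX⟩ := Rep.exists_shortExact_toCoind A ⊥
    have := isIso_δ_of_isZero hX (n + 2) (isZero_coind_bot _ _) (isZero_coind_bot _ _)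
    exact (ih B).of_iso (asIso (δ hX (n + 2) (n + 3) rfl)).symm

end Free

end groupCohomology

/-! ### Sign twists and the twist exact sequence -/

namespace Representation

variable {G V : Type} [Group G] [AddCommGroup V] (χ : G →* ℤˣ) (ρ : Representation ℤ G V)

/-- The twist of a representation by a sign character. -/
noncomputable def signTwist : Representation ℤ G V where
  toFun g := (χ g : ℤ) • ρ g
  map_one' := by simp
  map_mul' g h := by rw [map_mul, map_mul, Units.val_mul, smul_mul_smul_comm]

theorem signTwist_apply (g : G) (v : V) : signTwist χ ρ g v = (χ g : ℤ) • ρ g v := rfl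

theorem signTwist_of_eq_one {g : G} (h : χ g = 1) : signTwist χ ρ g = ρ g := by
  ext v; simp [signTwist_apply, h]

theorem signTwist_of_eq_neg_one {g : G} (h : χ g = -1) (v : V) :
    signTwist χ ρ g v = -ρ g v := by
  simp [signTwist_apply, h]

theorem signTwist_signTwist : signTwist χ (signTwist χ ρ) = ρ := by
  ext g v
  simp [signTwist_apply, smul_smul, ← Units.val_mul]

/-- Signs are invisible modulo two. -/
theorem signTwist_sub_self_even (h : ∀ g v, ∃ w, ρ g v - v = w + w) (g : G) (v : V) :
    ∃ w, signTwist χ ρ g v - v = w + w := by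
  obtain ⟨w, hw⟩ := h g v
  rcases Int.units_eq_one_or (χ g) with h1 | h1
  · exact ⟨w, by rw [signTwist_of_eq_one χ ρ h1, hw]⟩
  · refine ⟨-w - v, ?_⟩
    rw [signTwist_of_eq_neg_one χ ρ h1, sub_eq_iff_eq_add.1 hw]
    abel

end Representation

namespace Rep

open CategoryTheory Representation

variable {G V : Type} [Group G] [AddCommGroup V] (χ : G →* ℤˣ) (ρ : Representation ℤ G V) {c : G}

theorem mem_ker_of_eq_neg_one (hχ : χ c = -1) {g : G} (hg : χ g = -1) : g * c ∈ χ.ker := by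
  simp [MonoidHom.mem_ker, hχ, hg]

theorem coind_apply_of_mem (f : coind χ.ker.subtype (res χ.ker.subtype (of ρ))) {g : G}
    (hg : χ g = 1) (h : G) : f.1 (g * h) = ρ g (f.1 h) := f.2 ⟨g, hg⟩ h

/-- Since 1 and `c` represent the cosets of `ker χ`, an element of the coinduced module is
determined by its values there. -/
theorem coind_apply_of_eq_neg_one (hcc : c * c = 1) (hχ : χ c = -1)
    (f : coind χ.ker.subtype (res χ.ker.subtype (of ρ))) {g : G} (hg : χ g = -1) :
    f.1 g = ρ g (ρ c (f.1 c)) := by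
  have h := coind_apply_of_mem χ ρ f (mem_ker_of_eq_neg_one χ hχ hg) c
  rw [mul_assoc, hcc, mul_one] at h
  rw [h, map_mul]
  rfl

/-- The map `f ↦ f 1 - c (f c)` from the coinduced module to the twist. -/
noncomputable def coindToTwist (hc : ∀ g, c * g = g * c) (hcc : c * c = 1) (hχ : χ c = -1) :
    coind χ.ker.subtype (res χ.ker.subtype (of ρ)) ⟶ of (signTwist χ ρ) :=
  ofHom
    { toFun f := f.1 1 - ρ c (f.1 c)
      map_add' f g := by
        change (f.1 1 + g.1 1) - ρ c (f.1 c + g.1 c) = _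
        rw [map_add]; abel
      map_smul' r f := by
        change r • f.1 1 - ρ c (r • f.1 c) = r • (f.1 1 - ρ c (f.1 c))
        rw [map_smul, smul_sub]
      isIntertwining' h := by
        ext f
        change f.1 (1 * h) - ρ c (f.1 (c * h)) = signTwist χ ρ h (f.1 1 - ρ c (f.1 c))
        have hc2 (v : V) : ρ c (ρ c v) = v := by
          rw [← Module.End.mul_apply, ← map_mul, hcc, map_one]; rfl
        have hcg (g : G) (v : V) : ρ c (ρ g v) = ρ g (ρ c v) := by
          rw [← Module.End.mul_apply, ← map_mul, hc, map_mul]; rfl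
        rw [one_mul]
        rcases Int.units_eq_one_or (χ h) with h1 | h1
        · have e1 := coind_apply_of_mem χ ρ f h1 1
          rw [mul_one] at e1
          rw [signTwist_of_eq_one χ ρ h1, e1, hc h, coind_apply_of_mem χ ρ f h1, map_sub, hcg]
        · have e1 := coind_apply_of_mem χ ρ f (mem_ker_of_eq_neg_one χ hχ h1) 1
          rw [mul_one] at e1
          rw [signTwist_of_eq_neg_one χ ρ h1, coind_apply_of_eq_neg_one χ ρ hcc hχ f h1, hc h, e1,
            map_mul, Module.End.mul_apply, hcg, hc2, map_sub]
          abel }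

variable (hc : ∀ g, c * g = g * c) (hcc : c * c = 1) (hχ : χ c = -1)

/-- The short complex `A ⟶ Coind Res A ⟶ A ⊗ χ`. -/
noncomputable def twistComplex : ShortComplex (Rep.{0} ℤ G) :=
  ShortComplex.mk (toCoind (of ρ) χ.ker) (coindToTwist χ ρ hc hcc hχ) (by
    ext v
    change ρ 1 v - ρ c (ρ c v) = 0
    rw [← Module.End.mul_apply, ← map_mul, hcc, sub_self])

theorem twistComplex_shortExact : (twistComplex χ ρ hc hcc hχ).ShortExact := by
  refine shortExact_of_linear _ (toCoind_injective _ _) (fun v => ?_) fun f hf => ?_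
  · classical
    -- The preimage of `v` is supported on `ker χ`, so its value at `c` is zero and its value at 1
    -- is `v`.
    refine ⟨⟨fun g => if χ g = 1 then ρ g v else 0, fun s g => ?_⟩, ?_⟩
    · have hs : χ s = 1 := s.2
      by_cases h : χ g = 1
      · simp [hs, h]
        rfl
      · simp [hs, h]
    · change (if χ 1 = 1 then ρ 1 v else 0) - ρ c (if χ c = 1 then ρ c v else 0) = v
      simp [hχ]
      rfl
  · refine ⟨f.1 1, Subtype.ext (funext fun g => ?_)⟩
    change ρ g (f.1 1) = f.1 g
    have h1 : f.1 1 = ρ c (f.1 c) := sub_eq_zero.1 hf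
    rcases Int.units_eq_one_or (χ g) with h | h
    · rw [← coind_apply_of_mem χ ρ f h 1, mul_one]
    · rw [coind_apply_of_eq_neg_one χ ρ hcc hχ f h, h1]

/-- The map from the twist to the coinduced module given by `v ↦ (g ↦ χ(g) g v)`. -/
noncomputable def twistToCoind :
    of (signTwist χ ρ) ⟶ coind χ.ker.subtype (res χ.ker.subtype (of ρ)) :=
  ofHom
    { toFun v := ⟨fun g => signTwist χ ρ g v, fun s g => by
        have hs : χ s = 1 := s.2
        change signTwist χ ρ (s * g) v = ρ s (signTwist χ ρ g v)
        rw [map_mul, signTwist_of_eq_one χ ρ hs]; rfl⟩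
      map_add' a b := by ext; simp
      map_smul' r a := by ext; simp
      isIntertwining' g := by
        ext a h
        change signTwist χ ρ h (signTwist χ ρ g a) = signTwist χ ρ (h * g) a
        simp }

/-- Shows that doubles in the cohomology of the twist come from the coinduced module, hence die
under δ. -/
theorem coindToTwist_twistToCoind (v : V) :
    (coindToTwist χ ρ hc hcc hχ).hom ((twistToCoind χ ρ).hom v) = v + v := by
  change signTwist χ ρ 1 v - ρ c (signTwist χ ρ c v) = v + v
  rw [signTwist_of_eq_neg_one χ ρ hχ, map_neg, ← Module.End.mul_apply, ← map_mul, hcc]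
  simp

end Rep

namespace groupCohomology

open CategoryTheory Representation Rep

variable {G V : Type} [Group G] [AddCommGroup V] (χ : G →* ℤˣ) (ρ : Representation ℤ G V) {c : G}
  (hc : ∀ g, c * g = g * c) (hcc : c * c = 1) (hχ : χ c = -1)
  {α : Type} (e : FreeGroup α ≃* χ.ker)

include e in
theorem isZero_coind_of_free (A : Rep.{0} ℤ χ.ker) (n : ℕ) :
    Limits.IsZero (groupCohomology (coind χ.ker.subtype A) (n + 2)) :=
  (isZero_of_free e n A).of_iso (coindIso A (n + 2))

include hc hcc hχ e in
/-- Twisting by the sign shifts the cohomology in degrees at least two. -/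
theorem nonempty_twist_shift (n : ℕ) :
    Nonempty (groupCohomology (of ρ) (n + 3) ≃ₗ[ℤ] groupCohomology (of (signTwist χ ρ)) (n + 2)) := by
  have := isIso_δ_of_isZero (twistComplex_shortExact χ ρ hc hcc hχ) (n + 2)
    (isZero_coind_of_free χ e _ n) (isZero_coind_of_free χ e _ (n + 1))
  exact ⟨(asIso (δ (twistComplex_shortExact χ ρ hc hcc hχ) (n + 2) (n + 3)
    rfl)).symm.toLinearEquiv⟩

include e in
theorem δ_twist_surjective :
    Function.Surjective (δ (twistComplex_shortExact χ ρ hc hcc hχ) 1 2 rfl) :=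
  (ModuleCat.epi_iff_surjective _).1 (epi_δ_of_isZero _ 1 (isZero_coind_of_free χ e _ 0))

end groupCohomology

/-! ### Reduction of abelian groups modulo two -/

section ModTwo

variable {P Q R : Type*} [AddCommGroup P] [AddCommGroup Q] [AddCommGroup R]

theorem AddEquiv.nonempty_intLinearEquiv [Module ℤ P] [Module ℤ Q] (e : P ≃+ Q) :
    Nonempty (P ≃ₗ[ℤ] Q) :=
  ⟨{ e with map_smul' := fun n x => map_intCast_smul e ℤ ℤ n x }⟩

/-- Two surjections with the same kernel have isomorphic targets. -/
theorem AddMonoidHom.nonempty_addEquiv_of_ker_eq (f : P →+ Q) (g : P →+ R)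
    (hf : Function.Surjective f) (hg : Function.Surjective g) (h : ∀ p, f p = 0 ↔ g p = 0) :
    Nonempty (Q ≃+ R) := by
  have hk : f.ker = g.ker := by ext p; exact h p
  exact ⟨(QuotientAddGroup.quotientKerEquivOfSurjective f hf).symm.trans
    ((QuotientAddGroup.quotientAddEquivOfEq hk).trans
      (QuotientAddGroup.quotientKerEquivOfSurjective g hg))⟩

variable (P) [Module ℤ P]

/-- The reduction map `P → P ⊗ ℤ/2`. -/
noncomputable def tensorModTwo : P →+ P ⊗[ℤ] ZMod 2 :=
  { toFun p := p ⊗ₜ 1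
    map_zero' := TensorProduct.zero_tmul _ _
    map_add' p q := TensorProduct.add_tmul p q 1 }

variable {P}

theorem tensorModTwo_surjective : Function.Surjective (tensorModTwo P) := by
  obtain rfl : ‹Module ℤ P› = AddCommGroup.toIntModule P := Subsingleton.elim _ _
  intro x
  induction x using TensorProduct.induction_on with
  | zero => exact ⟨0, map_zero _⟩
  | tmul p n =>
    obtain ⟨m, rfl⟩ := ZMod.intCast_surjective n
    refine ⟨m • p, ?_⟩
    change (m • p) ⊗ₜ[ℤ] (1 : ZMod 2) = _
    rw [TensorProduct.smul_tmul, zsmul_one]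
  | add x y hx hy =>
    obtain ⟨p, rfl⟩ := hx
    obtain ⟨q, rfl⟩ := hy
    exact ⟨p + q, map_add _ _ _⟩

theorem tensorModTwo_eq_zero_iff (p : P) : tensorModTwo P p = 0 ↔ ∃ q, p = q + q := by
  obtain rfl : ‹Module ℤ P› = AddCommGroup.toIntModule P := Subsingleton.elim _ _
  constructor
  · intro h
    -- The kernel is detected by the map `P ⊗ ℤ/2 → P/2P` sending `p ⊗ 1` to the class of `p`.
    let D : AddSubgroup P := (nsmulAddMonoidHom 2 : P →+ P).range
    have hD (q : P) : 2 • (q : P ⧸ D) = 0 :=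
      (QuotientAddGroup.eq_zero_iff (2 • q)).2 ⟨q, rfl⟩
    let B : P →+ ZMod 2 →+ (P ⧸ D) :=
      { toFun q := ZMod.lift 2 ⟨zmultiplesHom (P ⧸ D) (q : P ⧸ D), by
          simpa [← two_nsmul, two_zsmul] using hD q⟩
        map_zero' := by
          ext n
          obtain ⟨m, rfl⟩ := ZMod.intCast_surjective n
          simp [ZMod.lift_coe]
        map_add' a b := by
          ext n
          obtain ⟨m, rfl⟩ := ZMod.intCast_surjective n
          simp [ZMod.lift_coe] }
    let L : P ⊗[ℤ] ZMod 2 →+ P ⧸ D := TensorProduct.liftAddHom B fun r q n => by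
      rw [map_zsmul B r q, map_zsmul (B q) r n]
      rfl
    have h1 : L (p ⊗ₜ 1) = p := by
      change B p 1 = _
      rw [← Int.cast_one]
      exact (ZMod.lift_coe 2 _ 1).trans (one_zsmul _)
    have h2 : p ⊗ₜ[ℤ] (1 : ZMod 2) = 0 := h
    rw [h2, map_zero] at h1
    obtain ⟨q, hq⟩ := (QuotientAddGroup.eq_zero_iff p).1 h1.symm
    exact ⟨q, by rw [← hq, nsmulAddMonoidHom_apply, two_nsmul]⟩
  · rintro ⟨q, rfl⟩
    change (q + q) ⊗ₜ[ℤ] (1 : ZMod 2) = 0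
    rw [← two_smul ℤ, TensorProduct.smul_tmul, show (2 : ℤ) • (1 : ZMod 2) = 0 from by decide,
      TensorProduct.tmul_zero]

theorem nonempty_tensorModTwo_equiv (f : P →+ Q) (hf : Function.Surjective f)
    (h : ∀ p, f p = 0 ↔ ∃ q, p = q + q) : Nonempty (Q ≃+ P ⊗[ℤ] ZMod 2) :=
  f.nonempty_addEquiv_of_ker_eq (tensorModTwo P) hf tensorModTwo_surjective fun p => by
    rw [h, tensorModTwo_eq_zero_iff]

theorem AddEquiv.nonempty_tensorModTwo_congr [Module ℤ Q] (e : P ≃+ Q) :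
    Nonempty (P ⊗[ℤ] ZMod 2 ≃+ Q ⊗[ℤ] ZMod 2) := by
  obtain rfl : ‹Module ℤ P› = AddCommGroup.toIntModule P := Subsingleton.elim _ _
  obtain rfl : ‹Module ℤ Q› = AddCommGroup.toIntModule Q := Subsingleton.elim _ _
  obtain ⟨l⟩ := e.nonempty_intLinearEquiv
  exact ⟨(TensorProduct.congr l (LinearEquiv.refl ℤ _)).toAddEquiv⟩

end ModTwo

/-! ### First cohomology in the presence of a central involution -/

namespace groupCohomology

open CategoryTheory Representation Rep

section NegOne

variable {G V : Type} [Group G] [AddCommGroup V] {ρ : Representation ℤ G V} {c : G}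
  (hc : ∀ g, c * g = g * c) (hρ : ∀ v, ρ c v = -v) (htf : ∀ v : V, v + v = 0 → v = 0)

theorem cocycle_mul (z : cocycles₁ (of ρ)) (g h : G) : z (g * h) = ρ g (z h) + z g :=
  (mem_cocycles₁_iff z).1 z.2 g h

include hc hρ htf in
-- Comparing `z (c * g)` with `z (g * c)` gives `2 z(g) = z(c) - g z(c)`; cancelling the two leaves
-- `z(g) = v - g v`, the coboundary of `-v`.
theorem H1π_eq_zero_of_apply_eq (z : cocycles₁ (of ρ)) {v : V} (h : z c = v + v) :
    H1π (of ρ) z = 0 := by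
  refine (H1π_eq_zero_iff z).2 ⟨-v, funext fun g => ?_⟩
  change ρ g (-v) - -v = z g
  have h1 := cocycle_mul z c g
  rw [hc, cocycle_mul z, hρ, h, map_add] at h1
  refine sub_eq_zero.1 (htf _ ?_)
  rw [map_neg]
  calc _ = -z g + (v + v) - (ρ g v + ρ g v + z g) := by abel
    _ = 0 := by rw [h1, sub_self]

include hc hρ htf in
theorem H1π_eq_zero_iff_apply (z : cocycles₁ (of ρ)) :
    H1π (of ρ) z = 0 ↔ ∃ v : V, z c = v + v := by
  refine ⟨fun h => ?_, fun ⟨v, hv⟩ => H1π_eq_zero_of_apply_eq hc hρ htf z hv⟩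
  obtain ⟨v, hv⟩ := (H1π_eq_zero_iff z).1 h
  have h1 : ρ c v - v = z c := congrFun hv c
  exact ⟨-v, by rw [← h1, hρ]; abel⟩

include htf in
-- The cocycle is `g ↦ (v - g v) / 2`, which makes sense because the action is trivial modulo two.
theorem exists_cocycle_apply_eq (hρ : ∀ v, ρ c v = -v)
    (hmod : ∀ g v, ∃ w, ρ g v - v = w + w) (v : V) : ∃ z : cocycles₁ (of ρ), z c = v := by
  choose w hw using fun g => hmod g (-v)
  have inj {a b : V} (h : a + a = b + b) : a = b :=
    sub_eq_zero.1 (htf _ (by rw [sub_add_sub_comm, h, sub_self]))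
  refine ⟨⟨w, (mem_cocycles₁_iff _).2 fun g h => inj ?_⟩, inj ?_⟩
  · change _ = (ρ g (w h) + w g) + (ρ g (w h) + w g)
    rw [add_add_add_comm, ← map_add, ← hw, ← hw, ← hw, map_mul, Module.End.mul_apply, map_sub]
    abel
  · change w c + w c = _
    rw [← hw, hρ]; abel

include hc hρ htf in
theorem nonempty_H1_equiv_tensor (hmod : ∀ g v, ∃ w, ρ g v - v = w + w) :
    Nonempty (groupCohomology (of ρ) 1 ≃+ V ⊗[ℤ] ZMod 2) := by
  let ev : cocycles₁ (of ρ) →+ V :=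
    { toFun z := z c, map_zero' := rfl, map_add' := fun _ _ => rfl }
  refine AddMonoidHom.nonempty_addEquiv_of_ker_eq (H1π (of ρ)).hom.toAddMonoidHom
    ((tensorModTwo V).comp ev) ((ModuleCat.epi_iff_surjective _).1 inferInstance)
    (tensorModTwo_surjective.comp (exists_cocycle_apply_eq htf hρ hmod)) fun z => ?_
  rw [AddMonoidHom.comp_apply, tensorModTwo_eq_zero_iff]
  exact H1π_eq_zero_iff_apply hc hρ htf z

end NegOne

section Restriction

variable {G K V : Type} [Group G] [Group K] [AddCommGroup V] {χ : G →* ℤˣ} {c : G}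
  (hc : ∀ g, c * g = g * c) (hcc : c * c = 1) (hχ : χ c = -1) {f : K →* G}

include hc hcc hχ in
-- The retraction multiplies elements of sign -1 by `c`; it is multiplicative since `c` is central
-- of square one.
theorem exists_retraction (hf : Function.Injective f) (hr : f.range = χ.ker) :
    ∃ p : G →* K, (∀ k, p (f k) = k) ∧ ∀ g, f (p g) = g ∨ f (p g) = g * c := by
  have hk (k : K) : χ (f k) = 1 := by
    have : f k ∈ χ.ker := hr ▸ ⟨k, rfl⟩
    exact this
  have key (g : G) : ∃ k, f k = g ∨ f k = g * c := by
    rcases Int.units_eq_one_or (χ g) with h | h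
    · have : g ∈ f.range := hr ▸ (MonoidHom.mem_ker.2 h)
      obtain ⟨k, hk⟩ := this
      exact ⟨k, Or.inl hk⟩
    · have : g * c ∈ f.range := hr ▸ mem_ker_of_eq_neg_one χ hχ h
      obtain ⟨k, hk⟩ := this
      exact ⟨k, Or.inr hk⟩
  choose p hp using key
  have uniq {k g} (h : f k = g ∨ f k = g * c) : p g = k := by
    apply hf
    have h1 := hk (p g)
    have h2 := hk k
    rcases h with h | h <;> rcases hp g with h' | h' <;> rw [h, h'] <;>
      rw [h] at h2 <;> rw [h'] at h1 <;> rw [map_mul, hχ] at * <;> simp_all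
  refine ⟨⟨⟨p, uniq (Or.inl (map_one f))⟩, fun g h => uniq ?_⟩, fun k => uniq (Or.inl rfl), hp⟩
  rw [map_mul]
  rcases hp g with h1 | h1 <;> rcases hp h with h2 | h2 <;> rw [h1, h2]
  · exact Or.inl rfl
  · exact Or.inr (mul_assoc _ _ _).symm
  · exact Or.inr (by rw [mul_assoc, hc, mul_assoc])
  · exact Or.inl (by rw [mul_assoc, ← mul_assoc c, hc, mul_assoc, hcc, mul_one])

variable {ρ : Representation ℤ G V} {B : Rep.{0} ℤ K} (φ : res f (of ρ) ⟶ B)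
  (hφ : Function.Bijective φ.hom) (hρ : ∀ v, ρ c v = v)
  {p : G →* K} (hp : ∀ k, p (f k) = k) (hfp : ∀ g, f (p g) = g ∨ f (p g) = g * c)

include hρ hfp in
theorem apply_retraction (g : G) : ρ (f (p g)) = ρ g := by
  rcases hfp g with h | h
  · rw [h]
  · ext v
    rw [h, map_mul, Module.End.mul_apply, hρ]

include hφ hρ hfp in
theorem map_H0_bijective : Function.Bijective (map f φ 0) := by
  have key (x : groupCohomology (of ρ) 0) :
      ((H0Iso B).hom (map f φ 0 x)).1 = φ.hom ((H0Iso (of ρ)).hom x).1 :=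
    map_H0Iso_hom_f_apply f φ x
  constructor
  · intro x y h
    have hx := key x
    rw [h, key y] at hx
    have h1 := Subtype.ext (hφ.1 hx)
    simpa using (congrArg (H0Iso (of ρ)).inv h1).symm
  · intro y
    obtain ⟨v, hv⟩ := hφ.2 ((H0Iso B).hom y).1
    have hinv : v ∈ (of ρ).ρ.invariants := by
      intro g
      change ρ g v = v
      rw [← apply_retraction hρ hfp]
      apply hφ.1
      have := hom_comm_apply φ (p g) v
      rw [hv] at this
      exact this.trans ((((H0Iso B).hom y).2 (p g)).trans hv.symm)
    refine ⟨(H0Iso (of ρ)).inv ⟨v, hinv⟩, ?_⟩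
    have h1 := key ((H0Iso (of ρ)).inv ⟨v, hinv⟩)
    have h2 : (H0Iso (of ρ)).hom ((H0Iso (of ρ)).inv ⟨v, hinv⟩) = ⟨v, hinv⟩ := by simp
    rw [h2] at h1
    have h3 := Subtype.ext (h1.trans hv)
    simpa using congrArg (H0Iso B).inv h3

include hφ hρ hfp hp hcc in
-- Since `c` acts trivially, `2 z(c) = z(c²) = 0`, so `z(c) = 0` and `z` is determined by its
-- restriction. Conversely, a cocycle on `K` extends by pulling back along the retraction `p`.
theorem map_H1_bijective (htf : ∀ v : V, v + v = 0 → v = 0) :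
    Function.Bijective (map f φ 1) := by
  constructor
  · refine (injective_iff_map_eq_zero _).2 fun x hx => ?_
    induction x using H1_induction_on with | h z =>
    rw [H1π_comp_map_apply] at hx
    obtain ⟨b, hb⟩ := (H1π_eq_zero_iff _).1 hx
    obtain ⟨v, rfl⟩ := hφ.2 b
    have hzf (k : K) : z (f k) = ρ (f k) v - v := by
      apply hφ.1
      have h1 : B.ρ k (φ.hom v) - φ.hom v = φ.hom (z (f k)) := congrFun hb k
      rw [← h1, ← hom_comm_apply, ← map_sub]
      rfl
    have hzc : z c = 0 := by
      apply htf
      have := cocycle_mul z c c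
      rw [hcc, cocycles₁_map_one, hρ] at this
      exact this.symm
    refine (H1π_eq_zero_iff z).2 ⟨v, funext fun g => ?_⟩
    change ρ g v - v = z g
    have h1 := hzf (p g)
    rw [apply_retraction hρ hfp] at h1
    rw [← h1]
    rcases hfp g with h | h
    · rw [h]
    · rw [h, cocycle_mul, hzc, map_zero, zero_add]
  · intro y
    induction y using H1_induction_on with | h y =>
    choose s hs using hφ.2
    refine ⟨H1π (of ρ) ⟨fun g => s (y (p g)), (mem_cocycles₁_iff _).2 fun g h => ?_⟩, ?_⟩
    · apply hφ.1
      change φ.hom (s (y (p (g * h)))) = φ.hom (ρ g (s (y (p h))) + s (y (p g)))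
      rw [hs, map_mul, (mem_cocycles₁_iff y).1 y.2, map_add, hs, ← apply_retraction hρ hfp]
      congr 1
      exact (congrArg _ (hs _).symm).trans (hom_comm_apply φ (p g) (s (y (p h)))).symm
    · rw [H1π_comp_map_apply]
      congr 1
      ext k
      rw [coe_mapCocycles₁]
      change φ.hom (s (y (p (f k)))) = y k
      rw [hs, hp]

end Restriction

end groupCohomology

/-! ### Second cohomology and periodicity -/

namespace groupCohomology

open CategoryTheory Representation Rep

variable {G V : Type} [Group G] [AddCommGroup V] (χ : G →* ℤˣ) (ρ : Representation ℤ G V) {c : G}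
  (hc : ∀ g, c * g = g * c) (hcc : c * c = 1) (hχ : χ c = -1)
  (htf : ∀ v : V, v + v = 0 → v = 0)
  {α : Type} (e : FreeGroup α ≃* χ.ker)

theorem map_coindToTwist_apply (z : cocycles₁ (coind χ.ker.subtype (res χ.ker.subtype (of ρ))))
    (g : G) :
    mapCocycles₁ (MonoidHom.id G) (coindToTwist χ ρ hc hcc hχ) z g =
      (z g).1 1 - ρ c ((z g).1 c) := rfl

theorem coind_cocycle_mul (z : cocycles₁ (coind χ.ker.subtype (res χ.ker.subtype (of ρ))))
    (g h x : G) : (z (g * h)).1 x = (z h).1 (x * g) + (z g).1 x := by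
  rw [(mem_cocycles₁_iff z).1 z.2 g h]
  rfl

include htf in
-- The relation `z(c²) = 0`, evaluated at 1, gives `z(c)(c) = -z(c)(1)`, so the image cocycle takes
-- an even value at `c`; on the twist, where `c` acts by -1, this makes it a coboundary.
theorem map_coindToTwist_eq_zero (hρ : ∀ v, ρ c v = v)
    (x : groupCohomology (coind χ.ker.subtype (res χ.ker.subtype (of ρ))) 1) :
    map (MonoidHom.id G) (coindToTwist χ ρ hc hcc hχ) 1 x = 0 := by
  have htw (v : V) : signTwist χ ρ c v = -v := by
    rw [signTwist_of_eq_neg_one χ ρ hχ, hρ]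
  induction x using H1_induction_on with | h z =>
  rw [H1π_comp_map_apply]
  refine H1π_eq_zero_of_apply_eq hc htw htf _ (v := (z c).1 1) ?_
  rw [map_coindToTwist_apply, hρ]
  have h1 := coind_cocycle_mul χ ρ z c c 1
  rw [hcc, cocycles₁_map_one, one_mul] at h1
  have h2 : (z c).1 c = -(z c).1 1 := eq_neg_of_add_eq_zero_left h1.symm
  rw [h2, sub_neg_eq_add]

include hc hcc hχ htf e in
/-- The second cohomology of a module on which the central involution acts trivially. -/
theorem nonempty_H2_equiv_tensor (hρ : ∀ v, ρ c v = v) (hmod : ∀ g v, ∃ w, ρ g v - v = w + w) :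
    Nonempty (groupCohomology (of ρ) 2 ≃+ V ⊗[ℤ] ZMod 2) := by
  have htw (v : V) : signTwist χ ρ c v = -v := by
    rw [signTwist_of_eq_neg_one χ ρ hχ, hρ]
  obtain ⟨e1⟩ := nonempty_H1_equiv_tensor hc htw htf (signTwist_sub_self_even χ ρ hmod)
  have hs := δ_twist_surjective χ ρ hc hcc hχ e
  have hi : Function.Injective (δ (twistComplex_shortExact χ ρ hc hcc hχ) 1 2 rfl) := by
    refine (injective_iff_map_eq_zero _).2 fun x hx => ?_
    obtain ⟨y, rfl⟩ := exists_map_eq_of_δ_eq_zero _ 1 x hx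
    exact map_coindToTwist_eq_zero χ ρ hc hcc hχ htf hρ y
  exact ⟨(AddEquiv.ofBijective (δ (twistComplex_shortExact χ ρ hc hcc hχ) 1 2 rfl).hom.toAddMonoidHom
    ⟨hi, hs⟩).symm.trans e1⟩

include hcc hc hχ htf in
/-- In the first cohomology of the twist, the classes coming from the coinduced module are the
multiples of two. -/
theorem exists_two_mul_eq_map_coindToTwist (hρ : ∀ v, ρ c v = -v)
    (x : groupCohomology (coind χ.ker.subtype (res χ.ker.subtype (of ρ))) 1) :
    ∃ q, map (MonoidHom.id G) (coindToTwist χ ρ hc hcc hχ) 1 x = q + q := by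
  have htw (v : V) : signTwist χ ρ c v = v := by
    rw [signTwist_of_eq_neg_one χ ρ hχ, hρ, neg_neg]
  have hker (s : χ.ker) : signTwist χ ρ s = ρ s := signTwist_of_eq_one χ ρ s.2
  obtain ⟨p, hp, hfp⟩ := exists_retraction hc hcc hχ (f := χ.ker.subtype)
    (Subgroup.subtype_injective _) (Subgroup.range_subtype _)
  have hbij := map_H1_bijective hcc (𝟙 (res χ.ker.subtype (of (signTwist χ ρ))))
    Function.bijective_id htw hp hfp htf
  induction x using H1_induction_on with | h z =>
  -- This is the Shapiro cocycle of `z`. Its class extends uniquely to `G`, and the extension is the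
  -- required half.
  let y : cocycles₁ (res χ.ker.subtype (of (signTwist χ ρ))) :=
    ⟨fun s => (z s).1 1, (mem_cocycles₁_iff _).2 fun s t => by
      change (z (s * t : G)).1 1 = signTwist χ ρ s ((z t).1 1) + (z s).1 1
      have h := coind_apply_of_mem χ ρ (z t) (g := s) s.2 1
      rw [mul_one] at h
      rw [coind_cocycle_mul, one_mul, hker, h]⟩
  obtain ⟨u, hu⟩ := hbij.2 (H1π _ y)
  refine ⟨u, hbij.1 ?_⟩
  rw [map_add, hu, H1π_comp_map_apply, H1π_comp_map_apply, ← map_add, H1π_eq_iff]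
  refine ⟨(z c).1 1, funext fun s => ?_⟩
  change signTwist χ ρ s ((z c).1 1) - (z c).1 1 =
    ((z s).1 1 - ρ c ((z s).1 c)) - ((z s).1 1 + (z s).1 1)
  -- Commuting `s` with `c` gives `z(s)(c) = z(s)(1) + s z(c)(1) - z(c)(1)`, so the image restricts
  -- to `2y` plus the coboundary of `z(c)(1)`.
  have h1 := coind_cocycle_mul χ ρ z s c 1
  have h2 := coind_apply_of_mem χ ρ (z c) (g := s) s.2 1
  rw [← hc, coind_cocycle_mul, one_mul, one_mul] at h1
  rw [mul_one] at h2
  rw [hker, ← h2, hρ, eq_sub_of_add_eq h1]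
  abel

include hc hcc hχ htf e in
/-- The second cohomology of a module on which the central involution acts by `-1`. -/
theorem nonempty_H2_equiv_H1_tensor (hρ : ∀ v, ρ c v = -v) :
    Nonempty (groupCohomology (of ρ) 2 ≃+
      groupCohomology (of (signTwist χ ρ)) 1 ⊗[ℤ] ZMod 2) := by
  refine nonempty_tensorModTwo_equiv
    (δ (twistComplex_shortExact χ ρ hc hcc hχ) 1 2 rfl).hom.toAddMonoidHom
    (δ_twist_surjective χ ρ hc hcc hχ e) fun x => ⟨fun hx => ?_, ?_⟩
  · obtain ⟨y, rfl⟩ := exists_map_eq_of_δ_eq_zero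
      (twistComplex_shortExact χ ρ hc hcc hχ) 1 x hx
    exact exists_two_mul_eq_map_coindToTwist χ ρ hc hcc hχ htf hρ y
  · rintro ⟨q, rfl⟩
    have hq : map (MonoidHom.id G) (coindToTwist χ ρ hc hcc hχ) 1
        (map (MonoidHom.id G) (twistToCoind χ ρ) 1 q) = q + q := by
      induction q using H1_induction_on with | h w =>
      rw [H1π_comp_map_apply, H1π_comp_map_apply, ← map_add]
      congr 1
      ext g
      exact coindToTwist_twistToCoind χ ρ hc hcc hχ (w g)
    rw [← hq]
    exact δ_map_apply (twistComplex_shortExact χ ρ hc hcc hχ) 1 _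

include hc hcc hχ htf e in
/-- The higher cohomology of a module on which the central involution acts trivially, and of its
twist. -/
theorem nonempty_cohomology_equiv (hρ : ∀ v, ρ c v = v) (hmod : ∀ g v, ∃ w, ρ g v - v = w + w)
    (i : ℕ) :
    (Nonempty (groupCohomology (of ρ) (2 * i + 2) ≃+ V ⊗[ℤ] ZMod 2) ∧
      Nonempty (groupCohomology (of ρ) (2 * i + 3) ≃+ groupCohomology (of ρ) 1 ⊗[ℤ] ZMod 2)) ∧
    (Nonempty (groupCohomology (of (signTwist χ ρ)) (2 * i + 1) ≃+ V ⊗[ℤ] ZMod 2) ∧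
      Nonempty (groupCohomology (of (signTwist χ ρ)) (2 * i + 2) ≃+
        groupCohomology (of ρ) 1 ⊗[ℤ] ZMod 2)) := by
  have htw (v : V) : signTwist χ ρ c v = -v := by
    rw [signTwist_of_eq_neg_one χ ρ hχ, hρ]
  have s1 (n : ℕ) := nonempty_twist_shift χ ρ hc hcc hχ e n
  have s2 (n : ℕ) : Nonempty (groupCohomology (of (signTwist χ ρ)) (n + 3) ≃ₗ[ℤ]
      groupCohomology (of ρ) (n + 2)) := by
    have h := nonempty_twist_shift χ (signTwist χ ρ) hc hcc hχ e n
    rwa [signTwist_signTwist] at h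
  have tr {A B : ModuleCat.{0} ℤ} {C : Type} [AddCommGroup C] :
      Nonempty (A ≃ₗ[ℤ] B) → Nonempty (B ≃+ C) → Nonempty (A ≃+ C) :=
    fun ⟨a⟩ ⟨b⟩ => ⟨a.toAddEquiv.trans b⟩
  induction i with
  | zero =>
    have h2 := nonempty_H2_equiv_H1_tensor χ (signTwist χ ρ) hc hcc hχ htf e htw
    rw [signTwist_signTwist] at h2
    exact ⟨⟨nonempty_H2_equiv_tensor χ ρ hc hcc hχ htf e hρ hmod, tr (s1 0) h2⟩,
      nonempty_H1_equiv_tensor hc htw htf (signTwist_sub_self_even χ ρ hmod), h2⟩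
  | succ i ih =>
    -- Two shifts, one for the module and one for its twist, raise the degree by two.
    obtain ⟨⟨h1, h2⟩, h3, h4⟩ := ih
    have h5 := tr (s2 (2 * i)) h1
    have h6 := tr (s2 (2 * i + 1)) h2
    exact ⟨⟨tr (s1 (2 * i + 1)) h5, tr (s1 (2 * i + 2)) h6⟩, h5, h6⟩

end groupCohomology

/-! ### Low-degree cohomology for free groups of rank two and trivial actions -/

namespace groupCohomology

open CategoryTheory Representation Rep

variable {G V : Type} [Group G] [AddCommGroup V] {ρ : Representation ℤ G V}
  (e : FreeGroup (Fin 2) ≃* G)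

include e in
/-- The reduction modulo two of the first cohomology of a free group of rank two, for a module
on which the group acts trivially modulo two. -/
theorem nonempty_H1_tensor_equiv_of_free (hmod : ∀ g v, ∃ w, ρ g v - v = w + w) :
    Nonempty (groupCohomology (of ρ) 1 ⊗[ℤ] ZMod 2 ≃+ (V × V) ⊗[ℤ] ZMod 2) := by
  let ev : cocycles₁ (of ρ) →+ V × V :=
    { toFun z := (z (e (FreeGroup.of 0)), z (e (FreeGroup.of 1)))
      map_zero' := rfl
      map_add' := fun _ _ => rfl }
  have hπ : Function.Surjective (H1π (of ρ)) := (ModuleCat.epi_iff_surjective _).1 inferInstance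
  have hcoc (v : V × V) : ∃ z, ev z = v := by
    obtain ⟨z, hz⟩ := exists_cocycle_of_free e (of ρ) ![v.1, v.2]
    exact ⟨z, Prod.ext (hz 0) (hz 1)⟩
  refine AddMonoidHom.nonempty_addEquiv_of_ker_eq
    ((tensorModTwo _).comp (H1π (of ρ)).hom.toAddMonoidHom) ((tensorModTwo (V × V)).comp ev)
    (tensorModTwo_surjective.comp hπ) (tensorModTwo_surjective.comp hcoc) fun z => ?_
  rw [AddMonoidHom.comp_apply, AddMonoidHom.comp_apply, tensorModTwo_eq_zero_iff,
    tensorModTwo_eq_zero_iff]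
  constructor
  · rintro ⟨q, hq⟩
    obtain ⟨w, rfl⟩ := hπ q
    change H1π (of ρ) z = H1π (of ρ) w + H1π (of ρ) w at hq
    rw [← map_add, H1π_eq_iff] at hq
    obtain ⟨b, hb⟩ := hq
    -- Coboundaries have even values because the action is trivial modulo two.
    have key (g : G) : ∃ v : V, z g = v + v := by
      obtain ⟨v, hv⟩ := hmod g b
      have h1 : ρ g b - b = z g - (w g + w g) := congrFun hb g
      exact ⟨v + w g, by rw [← sub_add_cancel (z g) (w g + w g), ← h1, hv]; abel⟩
    choose v hv using key
    exact ⟨(v _, v _), Prod.ext (hv _) (hv _)⟩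
  · rintro ⟨v, hv⟩
    obtain ⟨w, rfl⟩ := hcoc v
    refine ⟨H1π (of ρ) w, ?_⟩
    change H1π (of ρ) z = H1π (of ρ) w + H1π (of ρ) w
    rw [← map_add]
    congr 1
    refine cocycle_ext_of_free e fun i => ?_
    fin_cases i
    · exact congrArg Prod.fst hv
    · exact congrArg Prod.snd hv

include e in
/-- The first cohomology of a free group of rank two with trivial coefficients. -/
theorem nonempty_H1_equiv_prod_of_free (hρ : ∀ g v, ρ g v = v) :
    Nonempty (groupCohomology (of ρ) 1 ≃+ V × V) := by
  let ev : cocycles₁ (of ρ) →+ V × V :=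
    { toFun z := (z (e (FreeGroup.of 0)), z (e (FreeGroup.of 1)))
      map_zero' := rfl
      map_add' := fun _ _ => rfl }
  refine AddMonoidHom.nonempty_addEquiv_of_ker_eq (H1π (of ρ)).hom.toAddMonoidHom ev
    ((ModuleCat.epi_iff_surjective _).1 inferInstance) (fun v => ?_) fun z => ?_
  · obtain ⟨z, hz⟩ := exists_cocycle_of_free e (of ρ) ![v.1, v.2]
    exact ⟨z, Prod.ext (hz 0) (hz 1)⟩
  · change H1π (of ρ) z = 0 ↔ _
    rw [H1π_eq_zero_iff]
    constructor
    · rintro ⟨b, hb⟩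
      have h1 (g : G) : z g = 0 := by
        have h2 : ρ g b - b = z g := congrFun hb g
        rw [← h2, hρ, sub_self]
      exact Prod.ext (h1 _) (h1 _)
    · intro h
      have : z = 0 := by
        refine cocycle_ext_of_free e fun i => ?_
        fin_cases i
        · exact congrArg Prod.fst h
        · exact congrArg Prod.snd h
      rw [this]
      exact Submodule.zero_mem _

theorem nonempty_H0_equiv_of_trivial (hρ : ∀ g v, ρ g v = v) :
    Nonempty (groupCohomology (of ρ) 0 ≃+ V) := by
  have : ρ.IsTrivial := ⟨fun g => LinearMap.ext (hρ g)⟩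
  exact ⟨(H0IsoOfIsTrivial (of ρ)).toLinearEquiv.toAddEquiv⟩

theorem subsingleton_H0 (h : ∀ v, (∀ g, ρ g v = v) → v = 0) :
    Subsingleton (groupCohomology (of ρ) 0) := by
  have : Subsingleton ρ.invariants :=
    subsingleton_of_forall_eq 0 fun v => Subtype.ext (h v.1 v.2)
  exact (H0Iso (of ρ)).toLinearEquiv.toEquiv.subsingleton

end groupCohomology

/-! ### Structure of Γ(2): freeness of F₂ and the splitting by -I -/

namespace CongruenceCohomology

theorem s₁_sq : (s₁ ^ 2).1 = !![1, 0; -2, 1] := by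
  rw [sq, Matrix.SpecialLinearGroup.coe_mul]
  simp [s₁]

theorem s₂_sq : (s₂ ^ 2).1 = !![1, 2; 0, 1] := by
  rw [sq, Matrix.SpecialLinearGroup.coe_mul]
  simp [s₂]

theorem s₁_sq_inv : ((s₁ ^ 2)⁻¹).1 = !![1, 0; 2, 1] := by
  rw [Matrix.SpecialLinearGroup.coe_inv, s₁_sq, Matrix.adjugate_fin_two]
  simp

theorem s₂_sq_inv : ((s₂ ^ 2)⁻¹).1 = !![1, -2; 0, 1] := by
  rw [Matrix.SpecialLinearGroup.coe_inv, s₂_sq, Matrix.adjugate_fin_two]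
  simp

theorem det_eq (A : SL(2, ℤ)) : A 0 0 * A 1 1 - A 0 1 * A 1 0 = 1 := by
  have := A.2
  rwa [Matrix.det_fin_two] at this

theorem s₁_sq_mul (A : SL(2, ℤ)) :
    (s₁ ^ 2 * A) 0 0 = A 0 0 ∧ (s₁ ^ 2 * A) 1 0 = A 1 0 - 2 * A 0 0 := by
  simp only [Matrix.SpecialLinearGroup.coe_mul, s₁_sq, Matrix.mul_apply, Fin.sum_univ_two]
  simp; ring

theorem s₂_sq_mul (A : SL(2, ℤ)) :
    (s₂ ^ 2 * A) 0 0 = A 0 0 + 2 * A 1 0 ∧ (s₂ ^ 2 * A) 1 0 = A 1 0 := by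
  simp only [Matrix.SpecialLinearGroup.coe_mul, s₂_sq, Matrix.mul_apply, Fin.sum_univ_two]
  simp

theorem s₁_sq_inv_mul (A : SL(2, ℤ)) :
    ((s₁ ^ 2)⁻¹ * A) 0 0 = A 0 0 ∧ ((s₁ ^ 2)⁻¹ * A) 1 0 = A 1 0 + 2 * A 0 0 := by
  simp only [Matrix.SpecialLinearGroup.coe_mul, s₁_sq_inv, Matrix.mul_apply, Fin.sum_univ_two]
  simp; ring

theorem s₂_sq_inv_mul (A : SL(2, ℤ)) :
    ((s₂ ^ 2)⁻¹ * A) 0 0 = A 0 0 - 2 * A 1 0 ∧ ((s₂ ^ 2)⁻¹ * A) 1 0 = A 1 0 := by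
  simp only [Matrix.SpecialLinearGroup.coe_mul, s₂_sq_inv, Matrix.mul_apply, Fin.sum_univ_two]
  simp; ring

theorem col_ne_zero (A : SL(2, ℤ)) : A 0 0 ≠ 0 ∨ A 1 0 ≠ 0 := by
  by_contra! h
  have := det_eq A
  rw [h.1, h.2] at this
  simp at this

/-- Ping-pong on the slope of the first column. -/
theorem lift_injective : Function.Injective (FreeGroup.lift ![s₁ ^ 2, s₂ ^ 2]) := by
  -- For first column `(a, b)`, `s₁²` sends `b/a` to `b/a - 2` and `s₂²` sends `a/b` to `a/b + 2`.
  -- The sets are `b/a ≤ -1`, `a/b ≥ 1` for `X` and `b/a > 1`, `a/b < -1` for `Y`. Clearing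
  -- denominators puts `a = 0` in `X 0` and `b = 0` in `X 1`; the mix of strict and weak bounds
  -- keeps all four disjoint.
  let X : Fin 2 → Set SL(2, ℤ) :=
    ![{A | A 0 0 * A 1 0 ≤ -(A 0 0 * A 0 0)}, {A | A 1 0 * A 1 0 ≤ A 0 0 * A 1 0}]
  let Y : Fin 2 → Set SL(2, ℤ) :=
    ![{A | A 0 0 * A 0 0 < A 0 0 * A 1 0}, {A | A 0 0 * A 1 0 < -(A 1 0 * A 1 0)}]
  have sq_eq {A : SL(2, ℤ)} (h : A 0 0 * A 0 0 + A 1 0 * A 1 0 ≤ 0) : False := by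
    rcases col_ne_zero A with h1 | h1 <;> have := mul_self_pos.2 h1 <;>
      nlinarith [mul_self_nonneg (A 0 0), mul_self_nonneg (A 1 0)]
  have hX0 (A : SL(2, ℤ)) : A ∈ X 0 ↔ A 0 0 * A 1 0 ≤ -(A 0 0 * A 0 0) := Iff.rfl
  have hX1 (A : SL(2, ℤ)) : A ∈ X 1 ↔ A 1 0 * A 1 0 ≤ A 0 0 * A 1 0 := Iff.rfl
  have hY0 (A : SL(2, ℤ)) : A ∈ Y 0 ↔ A 0 0 * A 0 0 < A 0 0 * A 1 0 := Iff.rfl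
  have hY1 (A : SL(2, ℤ)) : A ∈ Y 1 ↔ A 0 0 * A 1 0 < -(A 1 0 * A 1 0) := Iff.rfl
  have d1 : Disjoint (X 0) (X 1) := Set.disjoint_left.2 fun A h1 h2 => by
    rw [hX0] at h1
    rw [hX1] at h2
    exact sq_eq (by linarith)
  have d2 : Disjoint (Y 0) (Y 1) := Set.disjoint_left.2 fun A h1 h2 => by
    rw [hY0] at h1
    rw [hY1] at h2
    nlinarith [mul_self_nonneg (A 0 0), mul_self_nonneg (A 1 0)]
  refine FreeGroup.injective_lift_of_ping_pong ![s₁ ^ 2, s₂ ^ 2] X Y ?_ ?_ ?_ ?_ ?_ ?_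
  · intro i
    fin_cases i
    · exact ⟨s₁, (hX0 _).2 (by simp [s₁])⟩
    · exact ⟨1, (hX1 _).2 (by simp)⟩
  · intro i j hij
    fin_cases i <;> fin_cases j
    · exact absurd rfl hij
    · exact d1
    · exact d1.symm
    · exact absurd rfl hij
  · intro i j hij
    fin_cases i <;> fin_cases j
    · exact absurd rfl hij
    · exact d2
    · exact d2.symm
    · exact absurd rfl hij
  · intro i j
    refine Set.disjoint_left.2 fun A h1 h2 => ?_
    have hu := mul_self_nonneg (A 0 0)
    have hv := mul_self_nonneg (A 1 0)
    fin_cases i <;> fin_cases j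
    · have h1 := (hX0 A).1 h1
      have h2 := (hY0 A).1 h2
      linarith
    · have h1 := (hX0 A).1 h1
      have h2 := (hY1 A).1 h2
      have h3 := mul_le_mul_of_nonneg_left h1 hv
      have h4 := mul_lt_mul_of_neg_left h2 (show A 0 0 * A 1 0 < 0 by linarith)
      linarith
    · have h1 := (hX1 A).1 h1
      have h2 := (hY0 A).1 h2
      have h3 := mul_le_mul_of_nonneg_left h1 hu
      have h4 := mul_lt_mul_of_pos_left h2 (show 0 < A 0 0 * A 1 0 by linarith)
      linarith
    · have h1 := (hX1 A).1 h1
      have h2 := (hY1 A).1 h2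
      linarith
  · rintro i _ ⟨A, hA, rfl⟩
    fin_cases i
    · have h := not_lt.1 (mt (hY0 A).2 hA)
      refine (hX0 (s₁ ^ 2 * A)).2 ?_
      rw [(s₁_sq_mul A).1, (s₁_sq_mul A).2]
      linarith
    · have h := not_lt.1 (mt (hY1 A).2 hA)
      refine (hX1 (s₂ ^ 2 * A)).2 ?_
      rw [(s₂_sq_mul A).1, (s₂_sq_mul A).2]
      linarith
  · rintro i _ ⟨A, hA, rfl⟩
    fin_cases i
    · have h := not_le.1 (mt (hX0 A).2 hA)
      refine (hY0 ((s₁ ^ 2)⁻¹ * A)).2 ?_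
      rw [(s₁_sq_inv_mul A).1, (s₁_sq_inv_mul A).2]
      linarith
    · have h := not_le.1 (mt (hX1 A).2 hA)
      refine (hY1 ((s₂ ^ 2)⁻¹ * A)).2 ?_
      rw [(s₂_sq_inv_mul A).1, (s₂_sq_inv_mul A).2]
      linarith

theorem range_lift : (FreeGroup.lift ![s₁ ^ 2, s₂ ^ 2]).range = F₂ := by
  rw [FreeGroup.range_lift_eq_closure, F₂]
  simp [Set.pair_comm]

theorem mem_Gamma2_iff (A : SL(2, ℤ)) :
    A ∈ Gamma2 ↔ A 0 0 % 2 = 1 ∧ A 0 1 % 2 = 0 ∧ A 1 0 % 2 = 0 ∧ A 1 1 % 2 = 1 := by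
  have h (a b : ℤ) : (a : ZMod 2) = b ↔ a % 2 = b % 2 := ZMod.intCast_eq_intCast_iff' a b 2
  have h1 (a : ℤ) := h a 1
  have h0 (a : ℤ) := h a 0
  simp only [Int.cast_one, Int.cast_zero] at h1 h0
  rw [CongruenceSubgroup.Gamma_mem, h1, h0, h0, h1]
  rfl

/-- The sign character of `Γ(2)`, given by the upper left entry modulo four. -/
noncomputable def sign : Gamma2 →* ℤˣ where
  toFun A := if A.1 0 0 % 4 = 1 then 1 else -1
  map_one' := by simp
  map_mul' A B := by
    have hA := (mem_Gamma2_iff A.1).1 A.2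
    have hB := (mem_Gamma2_iff B.1).1 B.2
    have h : (A * B).1 0 0 = A.1 0 0 * B.1 0 0 + A.1 0 1 * B.1 1 0 := by
      simp [Matrix.mul_apply]
    have h4 : (A.1 0 1 * B.1 1 0) % 4 = 0 := by
      obtain ⟨a, ha⟩ := Int.dvd_of_emod_eq_zero hA.2.1
      obtain ⟨b, hb⟩ := Int.dvd_of_emod_eq_zero hB.2.2.1
      rw [ha, hb]
      exact Int.emod_eq_zero_of_dvd ⟨a * b, by ring⟩
    have hA4 : A.1 0 0 % 4 = 1 ∨ A.1 0 0 % 4 = 3 := by omega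
    have hB4 : B.1 0 0 % 4 = 1 ∨ B.1 0 0 % 4 = 3 := by omega
    rw [h, Int.add_emod, h4, Int.mul_emod]
    rcases hA4 with h1 | h1 <;> rcases hB4 with h2 | h2 <;> simp [h1, h2]

theorem sign_eq_one_iff (A : Gamma2) : sign A = 1 ↔ A.1 0 0 % 4 = 1 := by
  change (if A.1 0 0 % 4 = 1 then (1 : ℤˣ) else -1) = 1 ↔ _
  split_ifs with h
  · simp [h]
  · simp [h]

theorem F₂_le : F₂ ≤ sign.ker.map Gamma2.subtype := by
  rw [F₂, Subgroup.closure_le]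
  rintro A (rfl | rfl)
  · refine ⟨⟨s₁ ^ 2, F₂_le_Gamma2 (Subgroup.subset_closure (by simp))⟩, ?_, rfl⟩
    exact (sign_eq_one_iff _).2 (by
      change (s₁ ^ 2).1 0 0 % 4 = 1
      rw [s₁_sq]
      simp)
  · refine ⟨⟨s₂ ^ 2, F₂_le_Gamma2 (Subgroup.subset_closure (by simp))⟩, ?_, rfl⟩
    exact (sign_eq_one_iff _).2 (by
      change (s₂ ^ 2).1 0 0 % 4 = 1
      rw [s₂_sq]
      simp)

theorem s₁_sq_mem : s₁ ^ 2 ∈ F₂ := Subgroup.subset_closure (by simp)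

theorem s₂_sq_mem : s₂ ^ 2 ∈ F₂ := Subgroup.subset_closure (by simp)

theorem s₂_sq_zpow (k : ℤ) : ((s₂ ^ 2) ^ k).1 = !![1, 2 * k; 0, 1] := by
  induction k using Int.induction_on with
  | zero => simp [Matrix.one_fin_two]
  | succ k ih =>
    rw [zpow_add_one, Matrix.SpecialLinearGroup.coe_mul, ih, s₂_sq]
    simp [mul_add, add_comm]
  | pred k ih =>
    rw [zpow_sub_one, Matrix.SpecialLinearGroup.coe_mul, ih, s₂_sq_inv]
    simp [sub_eq_add_neg, add_comm]
    ring

/-- Euclidean descent on the first column. -/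
theorem mem_F₂_of_mod_four (N : ℕ) (A : SL(2, ℤ)) (hN : (A 0 0).natAbs + (A 1 0).natAbs ≤ N)
    (hA : A ∈ Gamma2) (h : A 0 0 % 4 = 1) : A ∈ F₂ := by
  induction N generalizing A with
  | zero => omega
  | succ N ih =>
    obtain ⟨h1, h2, h3, h4⟩ := (mem_Gamma2_iff A).1 hA
    have step (B : SL(2, ℤ)) (hB : B ∈ F₂)
        (hlt : ((B * A) 0 0).natAbs + ((B * A) 1 0).natAbs ≤ N) (hm : (B * A) 0 0 % 4 = 1) :
        A ∈ F₂ :=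
      (Subgroup.mul_mem_cancel_left _ hB).1
        (ih (B * A) hlt (Subgroup.mul_mem _ (F₂_le_Gamma2 hB) hA) hm)
    have e1 := s₁_sq_mul A
    have e2 := s₂_sq_mul A
    have e3 := s₁_sq_inv_mul A
    have e4 := s₂_sq_inv_mul A
    by_cases hc : A 1 0 = 0
    · have hdet := det_eq A
      rw [hc, mul_zero, sub_zero] at hdet
      -- The descent ends at a column `(±1, 0)`; the condition modulo four excludes -1.
      have ha : A 0 0 = 1 := by
        rcases Int.eq_one_or_neg_one_of_mul_eq_one hdet with h' | h' <;> omega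
      obtain ⟨k, hk⟩ := Int.dvd_of_emod_eq_zero h2
      have : A = (s₂ ^ 2) ^ k := by
        ext i j
        rw [s₂_sq_zpow]
        rw [ha, one_mul] at hdet
        fin_cases i <;> fin_cases j <;> simp [ha, hk, hc, hdet]
      rw [this]
      exact Subgroup.zpow_mem _ s₂_sq_mem k
    -- The entries have opposite parity, so their absolute values differ; moving the larger towards
    -- zero by twice the smaller strictly decreases it. As `A 1 0` is even, `A 0 0` modulo four is
    -- unchanged.
    by_cases hlt : (A 0 0).natAbs < (A 1 0).natAbs
    · by_cases hs : 0 < A 0 0 ∧ 0 < A 1 0 ∨ A 0 0 < 0 ∧ A 1 0 < 0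
      · exact step _ s₁_sq_mem (by rw [e1.1, e1.2]; omega) (by rw [e1.1]; omega)
      · exact step _ (Subgroup.inv_mem _ s₁_sq_mem) (by rw [e3.1, e3.2]; omega)
          (by rw [e3.1]; omega)
    · by_cases hs : 0 < A 0 0 ∧ 0 < A 1 0 ∨ A 0 0 < 0 ∧ A 1 0 < 0
      · exact step _ (Subgroup.inv_mem _ s₂_sq_mem) (by rw [e4.1, e4.2]; omega)
          (by rw [e4.1]; omega)
      · exact step _ s₂_sq_mem (by rw [e2.1, e2.2]; omega) (by rw [e2.1]; omega)

/-- The inclusion of `F₂` in `Γ(2)` identifies it with the kernel of the sign character. -/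
theorem range_inclusion : (Subgroup.inclusion F₂_le_Gamma2).range = sign.ker := by
  ext A
  constructor
  · rintro ⟨B, rfl⟩
    obtain ⟨C, hC, hCB⟩ := F₂_le B.2
    have : C = Subgroup.inclusion F₂_le_Gamma2 B := Subtype.ext hCB
    rwa [← this]
  · intro h
    exact ⟨⟨A.1, mem_F₂_of_mod_four _ A.1 le_rfl A.2 ((sign_eq_one_iff A).1 h)⟩, rfl⟩

theorem nonempty_freeGroup_equiv_F₂ : Nonempty (FreeGroup (Fin 2) ≃* F₂) :=
  ⟨(MonoidHom.ofInjective lift_injective).trans (MulEquiv.subgroupCongr range_lift)⟩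

theorem nonempty_freeGroup_equiv_ker : Nonempty (FreeGroup (Fin 2) ≃* sign.ker) := by
  obtain ⟨e⟩ := nonempty_freeGroup_equiv_F₂
  exact ⟨(e.trans (MonoidHom.ofInjective (Subgroup.inclusion_injective F₂_le_Gamma2))).trans
    (MulEquiv.subgroupCongr range_inclusion)⟩

theorem neg_one_mem_Gamma2 : (-1 : SL(2, ℤ)) ∈ Gamma2 := by
  rw [mem_Gamma2_iff]
  simp

/-- The central element `-1` of `Γ(2)`. -/
def negOne : Gamma2 := ⟨-1, neg_one_mem_Gamma2⟩

theorem negOne_mul_self : negOne * negOne = 1 := Subtype.ext (by simp [negOne])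

theorem negOne_comm (g : Gamma2) : negOne * g = g * negOne := Subtype.ext (by simp [negOne])

theorem sign_negOne : sign negOne = -1 := by
  refine (Int.units_eq_one_or _).resolve_left fun h => ?_
  rw [sign_eq_one_iff] at h
  simp [negOne] at h

theorem disjoint_F₂ : Disjoint F₂ (Subgroup.zpowers (-1)) := by
  rw [Subgroup.disjoint_def]
  rintro A hA ⟨k, rfl⟩
  rcases Int.even_or_odd k with hk | hk
  · exact hk.neg_one_zpow
  · exfalso
    have h : negOne ∈ (Subgroup.inclusion F₂_le_Gamma2).range := by
      refine ⟨⟨_, hA⟩, Subtype.ext ?_⟩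
      exact hk.neg_one_zpow
    rw [range_inclusion, MonoidHom.mem_ker, sign_negOne] at h
    exact absurd h (by decide)

theorem F₂_sup : F₂ ⊔ Subgroup.zpowers (-1) = Gamma2 := by
  refine le_antisymm (sup_le F₂_le_Gamma2 (Subgroup.zpowers_le.2 neg_one_mem_Gamma2)) fun A hA => ?_
  have hm : (-1 : SL(2, ℤ)) ∈ F₂ ⊔ Subgroup.zpowers (-1) :=
    (le_sup_right : _ ≤ F₂ ⊔ _) (Subgroup.mem_zpowers _)
  -- The entry is odd, so either `A` or `-A` has upper left entry 1 modulo four.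
  by_cases h : A 0 0 % 4 = 1
  · exact (le_sup_left : F₂ ≤ _) (mem_F₂_of_mod_four _ A le_rfl hA h)
  · have h1 := (mem_Gamma2_iff A).1 hA
    have h2 : -1 * A ∈ F₂ := by
      refine mem_F₂_of_mod_four _ _ le_rfl (Subgroup.mul_mem _ neg_one_mem_Gamma2 hA) ?_
      simp
      omega
    exact (Subgroup.mul_mem_cancel_left _ hm).1 ((le_sup_left : F₂ ≤ _) h2)

end CongruenceCohomology

/-! ### The action on homogeneous polynomials -/

namespace CongruenceCohomology

open MvPolynomial

theorem repM_apply_coe (n : ℕ) (A : SL(2, ℤ)) (p : M n) :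
    (repM n A p : MvPolynomial (Fin 2) ℤ) = subst A.1 p := rfl

theorem M_eq_zero_of_add_self (n : ℕ) (p : M n) (h : p + p = 0) : p = 0 :=
  Subtype.ext (self_eq_neg.1 (eq_neg_of_add_eq_zero_left (congrArg Subtype.val h)))

theorem apply_add_apply_of_mem_support {n : ℕ} {p : MvPolynomial (Fin 2) ℤ}
    (hp : p.IsHomogeneous n) {d : Fin 2 →₀ ℕ} (hd : d ∈ p.support) : d 0 + d 1 = n := by
  have h := hp (mem_support_iff.1 hd)
  rw [Finsupp.weight_apply, Finsupp.sum_fintype _ _ (by simp), Fin.sum_univ_two] at h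
  simpa using h

theorem subst_neg_one_of_isHomogeneous {n : ℕ} {p : MvPolynomial (Fin 2) ℤ}
    (hp : p.IsHomogeneous n) : subst (-1) p = (-1) ^ n * p := by
  have h1 : subst (-1) p = ∑ d ∈ p.support, C (coeff d p) * ∏ i, (-X i) ^ d i := by
    rw [subst, aeval_def, eval₂_eq']
    refine Finset.sum_congr rfl fun d _ => ?_
    congr 1
    refine Finset.prod_congr rfl fun i _ => ?_
    congr 1
    fin_cases i <;> simp [Matrix.one_fin_two]
  conv_rhs => rw [p.as_sum, Finset.mul_sum]
  rw [h1]
  refine Finset.sum_congr rfl fun d hd => ?_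
  have hdn : d 0 + d 1 = n := apply_add_apply_of_mem_support hp hd
  rw [monomial_eq, Finsupp.prod_fintype _ _ (by simp), ← hdn]
  simp only [Fin.prod_univ_two]
  rw [neg_pow (X 0 : MvPolynomial (Fin 2) ℤ), neg_pow (X 1 : MvPolynomial (Fin 2) ℤ)]
  ring

theorem repM_negOne (n : ℕ) (p : M n) : repM n (-1) p = (-1 : ℤ) ^ n • p := by
  refine Subtype.ext ?_
  have := subst_neg_one_of_isHomogeneous p.2
  rw [repM_apply_coe, Matrix.SpecialLinearGroup.coe_neg, Matrix.SpecialLinearGroup.coe_one, this]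
  simp [zsmul_eq_mul]

/-- `Γ(2)` acts trivially modulo two. -/
theorem repM_sub_self_even (n : ℕ) (A : SL(2, ℤ)) (hA : A ∈ Gamma2) (p : M n) :
    ∃ q, repM n A p - p = q + q := by
  have hmap : (MvPolynomial.map (Int.castRingHom (ZMod 2))).comp (subst A.1).toRingHom =
      MvPolynomial.map (Int.castRingHom (ZMod 2)) := by
    obtain ⟨h1, h2, h3, h4⟩ := CongruenceSubgroup.Gamma_mem.1 hA
    refine MvPolynomial.ringHom_ext (fun r => by simp) fun i => ?_
    have hC (a : ℤ) : (a : MvPolynomial (Fin 2) (ZMod 2)) = C (a : ZMod 2) :=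
      (map_intCast (C : ZMod 2 →+* MvPolynomial (Fin 2) (ZMod 2)) a).symm
    fin_cases i
    · simp [subst, zsmul_eq_mul]
      simp [hC, h1, h3]
    · simp [subst, zsmul_eq_mul]
      simp [hC, h2, h4]
  have h0 : MvPolynomial.map (Int.castRingHom (ZMod 2)) (subst A.1 (p : MvPolynomial (Fin 2) ℤ) - (p : MvPolynomial (Fin 2) ℤ)) = 0 := by
    rw [map_sub, sub_eq_zero]
    exact DFunLike.congr_fun hmap _
  obtain ⟨q, hq⟩ := (C_dvd_iff_zmod 2 _).2 h0
  have hq' : subst A.1 (p : MvPolynomial (Fin 2) ℤ) - p = q + q := by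
    rw [hq, show ((2 : ℕ) : ℤ) = 1 + 1 from rfl, map_add, map_one]
    ring
  -- A nonzero coefficient of `q` remains nonzero in `2q`, which is homogeneous.
  have hh : q.IsHomogeneous n := by
    intro d hd
    have h2 : (subst A.1 (p : MvPolynomial (Fin 2) ℤ) - (p : MvPolynomial (Fin 2) ℤ)).IsHomogeneous n :=
      (repM n A p - p).2
    refine h2 (d := d) ?_
    rw [hq', coeff_add]
    omega
  exact ⟨⟨q, hh⟩, Subtype.ext hq'⟩

/-- A homogeneous polynomial invariant under the translation of one variable by a multiple of the
other does not involve the first. -/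
theorem apply_eq_zero_of_translation_invariant {n : ℕ} {p : MvPolynomial (Fin 2) ℤ}
    (hp : p.IsHomogeneous n) {a b : Fin 2} (hab : a ≠ b) {m : ℤ} (hm : m ≠ 0)
    (hinv : aeval (fun i => if i = b then X b + m • X a else X a) p = p)
    {d : Fin 2 →₀ ℕ} (hd : d ∈ p.support) : d b = 0 := by
  -- Dehomogenise by setting `X a = 1`. The result has period `m`, so it is constant; homogeneity
  -- makes its coefficients exactly those of `p`.
  let v : Fin 2 → Polynomial ℤ := fun i => if i = b then Polynomial.X else 1
  let q : Polynomial ℤ := aeval v p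
  have hT : (Polynomial.aeval (Polynomial.X + Polynomial.C m)).comp (aeval v) =
      (aeval v).comp (aeval (R := ℤ) fun i => if i = b then X b + m • X a else X a) := by
    ext i : 1
    by_cases h : i = b
    · simp [h, v, hab]
    · simp [h, v, hab]
  have hq : q.comp (Polynomial.X + Polynomial.C m) = q := by
    have h := DFunLike.congr_fun hT p
    rwa [AlgHom.comp_apply, AlgHom.comp_apply, hinv] at h
  have hk (k : ℕ) : q.eval (m * k) = q.eval 0 := by
    induction k with
    | zero => simp
    | succ k ih =>
      rw [← ih]
      conv_rhs => rw [← hq]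
      simp [Polynomial.eval_comp, mul_add]
  have hC : q = Polynomial.C (q.eval 0) := by
    refine Polynomial.eq_of_infinite_eval_eq _ _ (Set.Infinite.mono (s := Set.range fun k : ℕ =>
      m * (k : ℤ)) ?_ (Set.infinite_range_of_injective fun i j h => ?_))
    · rintro _ ⟨k, rfl⟩
      simp [hk]
    · exact_mod_cast mul_left_cancel₀ hm h
  have hsum (e : Fin 2 →₀ ℕ) (he : e ∈ p.support) : e a + e b = n := by
    have h := apply_add_apply_of_mem_support hp he
    obtain ⟨rfl, rfl⟩ | ⟨rfl, rfl⟩ : a = 0 ∧ b = 1 ∨ a = 1 ∧ b = 0 := by omega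
    · exact h
    · rwa [add_comm]
  have hcoeff : q.coeff (d b) = coeff d p := by
    have h1 : q = ∑ e ∈ p.support, Polynomial.C (coeff e p) * Polynomial.X ^ e b := by
      change aeval v p = _
      rw [aeval_def, eval₂_eq']
      refine Finset.sum_congr rfl fun e _ => ?_
      congr 1
      rw [Finset.prod_eq_single b (fun i _ hi => by simp [v, hi]) (by simp)]
      simp [v]
    rw [h1, Polynomial.finsetSum_coeff, Finset.sum_eq_single d]
    · simp
    · intro e he hne
      rw [Polynomial.coeff_C_mul_X_pow, if_neg]
      intro hb
      refine hne (Finsupp.ext fun i => ?_)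
      have h2 := hsum e he
      have h3 := hsum d hd
      have h4 : i = a ∨ i = b := by omega
      rcases h4 with rfl | rfl <;> omega
    · exact fun h => absurd hd h
  by_contra h0
  rw [hC, Polynomial.coeff_C_of_ne_zero h0] at hcoeff
  exact mem_support_iff.1 hd hcoeff.symm

/-- The generators act by `x ↦ x - 2y` and `y ↦ y + 2x`, so an invariant involves neither variable.
-/
theorem eq_zero_of_invariant_F₂ {n : ℕ} (hn : 0 < n) (p : M n)
    (h : ∀ A ∈ F₂, repM n A p = p) : p = 0 := by
  have e1 : subst (s₁ ^ 2).1 (p : MvPolynomial (Fin 2) ℤ) = p :=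
    congrArg Subtype.val (h _ s₁_sq_mem)
  have e2 : subst (s₂ ^ 2).1 (p : MvPolynomial (Fin 2) ℤ) = p :=
    congrArg Subtype.val (h _ s₂_sq_mem)
  rw [s₁_sq, subst] at e1
  rw [s₂_sq, subst] at e2
  refine Subtype.ext (support_eq_empty.1 (Finset.eq_empty_of_forall_notMem fun d hd => ?_))
  have h0 : d 0 = 0 := by
    refine apply_eq_zero_of_translation_invariant p.2 (a := 1) (b := 0) (m := -2) (by decide)
      (by decide) ?_ hd
    convert e1 using 3
    ext i : 1
    fin_cases i <;> simp
  have h1 : d 1 = 0 := by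
    refine apply_eq_zero_of_translation_invariant p.2 (a := 0) (b := 1) (m := 2) (by decide)
      (by decide) ?_ hd
    convert e2 using 3
    ext i : 1
    fin_cases i <;> simp [add_comm]
  have hdn := apply_add_apply_of_mem_support p.2 hd
  omega

theorem nonempty_M_zero_equiv : Nonempty (M 0 ≃+ ℤ) := by
  let f : ℤ →+ M 0 :=
    { toFun a := ⟨C a, isHomogeneous_C _ a⟩
      map_zero' := Subtype.ext (map_zero _)
      map_add' a b := Subtype.ext (map_add _ a b) }
  refine ⟨(AddEquiv.ofBijective f ⟨fun a b h => ?_, fun p => ?_⟩).symm⟩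
  · exact C_injective _ _ (congrArg Subtype.val h)
  · refine ⟨coeff 0 (p : MvPolynomial (Fin 2) ℤ), Subtype.ext ?_⟩
    exact (totalDegree_eq_zero_iff_eq_C.1 ((totalDegree_zero_iff_isHomogeneous _).2 p.2)).symm

theorem repM_zero_apply (A : SL(2, ℤ)) (p : M 0) : repM 0 A p = p := by
  refine Subtype.ext ?_
  rw [repM_apply_coe,
    totalDegree_eq_zero_iff_eq_C.1 ((totalDegree_zero_iff_isHomogeneous _).2 p.2)]
  exact algHom_C _ _

theorem repMmod2_apply (n : ℕ) (A : SL(2, ℤ)) (hA : A ∈ Gamma2) (x : M n ⊗[ℤ] ZMod 2) :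
    repMmod2 n A x = x := by
  induction x using TensorProduct.induction_on with
  | zero => exact map_zero _
  | tmul p a =>
    change repM n A p ⊗ₜ[ℤ] a = p ⊗ₜ[ℤ] a
    obtain ⟨q, hq⟩ := repM_sub_self_even n A hA p
    rw [sub_eq_iff_eq_add.1 hq, TensorProduct.add_tmul, add_eq_right, TensorProduct.add_tmul,
      ← TensorProduct.tmul_add, CharTwo.add_self_eq_zero, TensorProduct.tmul_zero]
  | add x y hx hy => rw [map_add, hx, hy]

end CongruenceCohomology

/-! ### Cohomology of Γ(2) with coefficients in M_n -/

namespace CongruenceCohomology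

open Representation groupCohomology

/-- `M_n` as a representation of `Γ(2)`. -/
noncomputable abbrev repΓ (n : ℕ) : Representation ℤ Gamma2 (M n) := (repM n).comp Gamma2.subtype

/-- `M_n` as a representation of `F₂`. -/
noncomputable abbrev repF (n : ℕ) : Representation ℤ F₂ (M n) := (repM n).comp F₂.subtype

theorem repΓ_sub_self_even (n : ℕ) (g : Gamma2) (p : M n) : ∃ q, repΓ n g p - p = q + q :=
  repM_sub_self_even n g.1 g.2 p

theorem repΓ_negOne_of_even {n : ℕ} (hn : Even n) (p : M n) : repΓ n negOne p = p := by
  change repM n (-1) p = p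
  rw [repM_negOne, hn.neg_one_pow, one_smul]

theorem repΓ_negOne_of_odd {n : ℕ} (hn : Odd n) (p : M n) : repΓ n negOne p = -p := by
  change repM n (-1) p = -p
  rw [repM_negOne, hn.neg_one_pow, neg_one_smul]

theorem restriction_bijective {n : ℕ} (hn : Even n) :
    Function.Bijective (restriction 0 n) ∧ Function.Bijective (restriction 1 n) := by
  obtain ⟨p, hp, hfp⟩ := exists_retraction negOne_comm negOne_mul_self sign_negOne
    (Subgroup.inclusion_injective F₂_le_Gamma2) range_inclusion
  exact ⟨map_H0_bijective (ρ := repΓ n) (B := Rep.of (repF n)) _ Function.bijective_id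
      (repΓ_negOne_of_even hn) hfp,
    map_H1_bijective (ρ := repΓ n) (B := Rep.of (repF n)) negOne_mul_self _
      Function.bijective_id (repΓ_negOne_of_even hn) hp hfp (M_eq_zero_of_add_self n)⟩

/-- For odd `n`, the twist of `M_n` restricts to `M_n` on `F₂`. -/
theorem nonempty_H1_signTwist_equiv {n : ℕ} (hn : Odd n) :
    Nonempty (groupCohomology (Rep.of (signTwist sign (repΓ n))) 1 ≃+ H 1 F₂ n) := by
  obtain ⟨p, hp, hfp⟩ := exists_retraction negOne_comm negOne_mul_self sign_negOne
    (Subgroup.inclusion_injective F₂_le_Gamma2) range_inclusion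
  let φ : Rep.res (Subgroup.inclusion F₂_le_Gamma2) (Rep.of (signTwist sign (repΓ n))) ⟶
      Rep.of (repF n) := Rep.ofHom ⟨LinearMap.id, fun g => by
    have hg : sign (Subgroup.inclusion F₂_le_Gamma2 g) = 1 :=
      MonoidHom.mem_ker.1 (range_inclusion ▸ ⟨g, rfl⟩)
    exact signTwist_of_eq_one sign (repΓ n) hg⟩
  have hb := map_H1_bijective (ρ := signTwist sign (repΓ n)) negOne_mul_self φ
    Function.bijective_id (fun v => by
      rw [signTwist_of_eq_neg_one _ _ sign_negOne, repΓ_negOne_of_odd hn, neg_neg])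
    hp hfp (M_eq_zero_of_add_self n)
  exact ⟨AddEquiv.ofBijective (groupCohomology.map _ φ 1).hom.toAddMonoidHom hb⟩

theorem nonempty_Hmod2_zero_equiv (n : ℕ) : Nonempty (Hmod2 0 F₂ n ≃+ M n ⊗[ℤ] ZMod 2) :=
  nonempty_H0_equiv_of_trivial fun g x => repMmod2_apply n g.1 (F₂_le_Gamma2 g.2) x

theorem nonempty_Hmod2_one_equiv (n : ℕ) :
    Nonempty (Hmod2 1 F₂ n ≃+ (M n × M n) ⊗[ℤ] ZMod 2) := by
  obtain ⟨e⟩ := nonempty_freeGroup_equiv_F₂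
  obtain ⟨a⟩ := nonempty_H1_equiv_prod_of_free (ρ := (repMmod2 n).comp F₂.subtype) e
    fun g x => repMmod2_apply n g.1 (F₂_le_Gamma2 g.2) x
  exact ⟨a.trans (TensorProduct.prodLeft ℤ ℤ (M n) (M n) (ZMod 2)).symm.toAddEquiv⟩

theorem nonempty_H1_tensor_equiv (n : ℕ) :
    Nonempty (H 1 F₂ n ⊗[ℤ] ZMod 2 ≃+ Hmod2 1 F₂ n) := by
  obtain ⟨e⟩ := nonempty_freeGroup_equiv_F₂
  obtain ⟨a⟩ := nonempty_H1_tensor_equiv_of_free (ρ := repF n) e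
    fun g p => repM_sub_self_even n g.1 (F₂_le_Gamma2 g.2) p
  obtain ⟨b⟩ := nonempty_Hmod2_one_equiv n
  exact ⟨a.trans b.symm⟩

theorem subsingleton_H0_F₂ {n : ℕ} (hn : 0 < n) : Subsingleton (H 0 F₂ n) :=
  subsingleton_H0 fun p hp => eq_zero_of_invariant_F₂ hn p fun A hA => hp ⟨A, hA⟩

theorem subsingleton_H0_Gamma2 {n : ℕ} (hn : 0 < n) : Subsingleton (H 0 Gamma2 n) :=
  subsingleton_H0 fun p hp =>
    eq_zero_of_invariant_F₂ hn p fun A hA => hp ⟨A, F₂_le_Gamma2 hA⟩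

theorem nonempty_H_even {n : ℕ} (hn : Even n) (i : ℕ) :
    Nonempty (H (2 * i + 2) Gamma2 n ≃+ M n ⊗[ℤ] ZMod 2) ∧
      Nonempty (H (2 * i + 3) Gamma2 n ≃+ H 1 F₂ n ⊗[ℤ] ZMod 2) := by
  obtain ⟨e⟩ := nonempty_freeGroup_equiv_ker
  obtain ⟨h1, ⟨h2⟩⟩ := (nonempty_cohomology_equiv sign (repΓ n) negOne_comm negOne_mul_self
    sign_negOne (M_eq_zero_of_add_self n) e (repΓ_negOne_of_even hn) (repΓ_sub_self_even n) i).1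
  obtain ⟨h3⟩ := (AddEquiv.ofBijective (restriction 1 n).hom.toAddMonoidHom
    (restriction_bijective hn).2).nonempty_tensorModTwo_congr
  exact ⟨h1, ⟨h2.trans h3⟩⟩

/-- For odd `n` it is the twist of `M_n` on which -I acts trivially, so the general result is
applied to that twist and read off on its own twist, which is `M_n`. -/
theorem nonempty_H_odd {n : ℕ} (hn : Odd n) (i : ℕ) :
    Nonempty (H (2 * i + 1) Gamma2 n ≃+ M n ⊗[ℤ] ZMod 2) ∧
      Nonempty (H (2 * i + 2) Gamma2 n ≃+ H 1 F₂ n ⊗[ℤ] ZMod 2) := by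
  obtain ⟨e⟩ := nonempty_freeGroup_equiv_ker
  have h := (nonempty_cohomology_equiv sign (signTwist sign (repΓ n)) negOne_comm negOne_mul_self
    sign_negOne (M_eq_zero_of_add_self n) e
    (fun v => by rw [signTwist_of_eq_neg_one _ _ sign_negOne, repΓ_negOne_of_odd hn, neg_neg])
    (signTwist_sub_self_even sign _ (repΓ_sub_self_even n)) i).2
  rw [signTwist_signTwist] at h
  obtain ⟨h1, ⟨h2⟩⟩ := h
  obtain ⟨a⟩ := nonempty_H1_signTwist_equiv hn
  obtain ⟨b⟩ := a.nonempty_tensorModTwo_congr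
  exact ⟨h1, ⟨h2.trans b⟩⟩

end CongruenceCohomology

open CongruenceCohomology in
theorem mainTheorem3 :
    -- `F₂` is freely generated by `s₁²` and `s₂²`, and `Γ(2) = F₂ × {1, -1}`
    Function.Injective (FreeGroup.lift ![s₁ ^ 2, s₂ ^ 2]) ∧
    Disjoint F₂ (Subgroup.zpowers (-1)) ∧ F₂ ⊔ Subgroup.zpowers (-1) = Gamma2 ∧
    -- even degree
    (∀ n : ℕ, Even n →
      Function.Bijective (restriction 0 n) ∧
      (n = 0 → Nonempty (H 0 F₂ n ≃ₗ[ℤ] ℤ)) ∧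
      (0 < n → Subsingleton (H 0 F₂ n)) ∧
      Function.Bijective (restriction 1 n) ∧
      ∀ i : ℕ, 0 < i →
        Nonempty (H (2 * i) Gamma2 n ≃ₗ[ℤ] Hmod2 0 F₂ n) ∧
        Nonempty (Hmod2 0 F₂ n ≃ₗ[ℤ] M n ⊗[ℤ] ZMod 2) ∧
        Nonempty (H (2 * i + 1) Gamma2 n ≃ₗ[ℤ] H 1 F₂ n ⊗[ℤ] ZMod 2)) ∧
    -- odd degree
    (∀ n : ℕ, Odd n →
      Subsingleton (H 0 Gamma2 n) ∧
      Subsingleton (H 0 F₂ n) ∧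
      ∀ i : ℕ, 0 < i →
        Nonempty (H (2 * i - 1) Gamma2 n ≃ₗ[ℤ] Hmod2 0 F₂ n) ∧
        Nonempty (Hmod2 0 F₂ n ≃ₗ[ℤ] M n ⊗[ℤ] ZMod 2) ∧
        Nonempty (H (2 * i) Gamma2 n ≃ₗ[ℤ] H 1 F₂ n ⊗[ℤ] ZMod 2) ∧
        Nonempty (H 1 F₂ n ⊗[ℤ] ZMod 2 ≃ₗ[ℤ] Hmod2 1 F₂ n)) ∧
    -- every degree
    (∀ n : ℕ, Nonempty (Hmod2 1 F₂ n ≃ₗ[ℤ] (M n × M n) ⊗[ℤ] ZMod 2)) := by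
  have lin {P Q : Type} [AddCommGroup P] [AddCommGroup Q] [Module ℤ P] [Module ℤ Q] :
      Nonempty (P ≃+ Q) → Nonempty (P ≃ₗ[ℤ] Q) := fun ⟨e⟩ => e.nonempty_intLinearEquiv
  have tr {P Q R : Type} [AddCommGroup P] [AddCommGroup Q] [AddCommGroup R] [Module ℤ P]
      [Module ℤ Q] : Nonempty (P ≃+ R) → Nonempty (Q ≃+ R) → Nonempty (P ≃ₗ[ℤ] Q) :=
    fun ⟨a⟩ ⟨b⟩ => (a.trans b.symm).nonempty_intLinearEquiv
  refine ⟨lift_injective, disjoint_F₂, F₂_sup, fun n hn => ?_, fun n hn => ?_,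
    fun n => lin (nonempty_Hmod2_one_equiv n)⟩
  · refine ⟨(restriction_bijective hn).1, ?_, subsingleton_H0_F₂, (restriction_bijective hn).2,
      fun i hi => ?_⟩
    · rintro rfl
      obtain ⟨a⟩ := groupCohomology.nonempty_H0_equiv_of_trivial (ρ := repF 0)
        fun g p => repM_zero_apply g.1 p
      obtain ⟨b⟩ := nonempty_M_zero_equiv
      exact lin ⟨a.trans b⟩
    · obtain ⟨k, rfl⟩ := Nat.exists_eq_add_of_lt hi
      have h := nonempty_H_even hn k
      rw [show 2 * (0 + k + 1) = 2 * k + 2 by ring]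
      exact ⟨tr h.1 (nonempty_Hmod2_zero_equiv n), lin (nonempty_Hmod2_zero_equiv n), lin h.2⟩
  · refine ⟨subsingleton_H0_Gamma2 hn.pos, subsingleton_H0_F₂ hn.pos, fun i hi => ?_⟩
    obtain ⟨k, rfl⟩ := Nat.exists_eq_add_of_lt hi
    have h := nonempty_H_odd hn k
    rw [show 2 * (0 + k + 1) = 2 * k + 2 by ring, show 2 * k + 2 - 1 = 2 * k + 1 from rfl]
    exact ⟨tr h.1 (nonempty_Hmod2_zero_equiv n), lin (nonempty_Hmod2_zero_equiv n), lin h.2,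
      lin (nonempty_H1_tensor_equiv n)⟩
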